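/- Let $(X_i)_{i\ge 1}$ be i.i.d. random variables with law $\nu$, defined on a probability space $(\Omega,\mathcal A,P)$ and taking values in a measurable space $(U,\mathcal U)$. Let $\lambda$ be Lebesgue measure on $[0,1]$ and $\lambda_n=n^{-1}\sum_{i=1}^n\delta_{i/n}$. For a function $q$ on $[0,1]\times U$ put $\mathbb P_n(q)=n^{-1}\sum_{i=1}^n q(i/n,X_i)$, and for a measure $\rho$ write $\rho(q)=\int q\,d\rho$. A class of real functions on a set $S$ is a *VC graph class* if the regions $\{(s,t)\in S\times\mathbb R: 0\le t\le f(s)\text{ or }f(s)\le t\le 0\}$, with $f$ in the class, form a Vapnik–Červonenkis class of sets (for some $d$, no set of $d$ points is shattered). A class of real functions on a measurable space $S$ is *permissible* if it can be written as $\{\varphi(\cdot,t):t\in T\}$, where $T$ is an analytic subset of a compact metric space, with its Borel $\sigma$-field, and $\varphi:S\times T\to\mathbb R$ is jointly measurable. Let $\mathcal H\subset\mathbb R^{[0,1]}$ and $\mathcal G\subset\mathbb R^{U}$ be permissible classes, and let $\mathcal F_\pi=\mathcal H\cdot\mathcal G=\{(s,x)\mapsto h(s)g(x):h\in\mathcal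 H,\ g\in\mathcal G\}$. Consider the conditions (H1) $\mathcal H$ is a uniformly bounded VC graph class of $\lambda$-almost everywhere continuous functions; (H2) $\mathcal G$ is a VC graph class with an everywhere finite envelope $G\in L_1(\nu)$, i.e. $|g(x)|\le G(x)<\infty$ for all $g\in\mathcal G$ and $x\in U$; (R) $\sup_{h\in\mathcal H}|\lambda_n(h)-\lambda(h)|\to 0$ as $n\to\infty$ ($\mathcal H$ is uniformly Riemann-integrable). (a) If (H1) and (H2) hold and $\mathcal F_\pi$ is a VC graph class of functions on $[0,1]\times U$, then $$\sup_{f\in\mathcal F_\pi}|\mathbb P_n(f)-(\lambda_n\otimes\nu)(f)|\to 0\quad\text{in }L_1(P).$$ If moreover (R) holds, then $$\sup_{f\in\mathcal F_\pi}|\mathbb P_n(f)-(\lambda\otimes\nu)(f)|\to 0\quad\text{in }L_1(P).$$ (b) If (H1) holds and $\mathcal G$ is a uniformly bounded VC graph class, then for every real $p\ge 1$ $$\sup_{f\in\mathcal F_\pi}|\mathbb P_n(f)-(\lambda_n\otimes\nu)(f)|\to 0\quad\text{in }L_p(P).$$ If moreover (R) holds, then for every real $p\ge 1$ $$\sup_{f\in\mathcal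 F_\pi}|\mathbb P_n(f)-(\lambda\otimes\nu)(f)|\to 0\quad\text{in }L_p(P).$$ In particular, these suprema are $P$-almost everywhere equal to measurable functions and belong to the respective $L_p(P)$. -/

import Mathlib

open MeasureTheory ProbabilityTheory Filter Topology
open scoped ENNReal

noncomputable section

namespace SeqEmp

/-! ### Vapnik-Chervonenkis graph classes -/

/-- The family `C` of subsets of `α` shatters the finite set `A`: every subset of `A` is the trace
on `A` of a member of `C`. -/
def Shatters {α : Type*} (C : Set (Set α)) (A : Finset α) : Prop :=
  ∀ B : Set α, B ⊆ ↑A → ∃ S ∈ C, ↑A ∩ S = B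

/-- `C` is a Vapnik-Chervonenkis class of sets: for some `d`, no set of `d` points is shattered. -/
def IsVCClass {α : Type*} (C : Set (Set α)) : Prop :=
  ∃ d : ℕ, ∀ A : Finset α, A.card = d → ¬ Shatters C A

/-- The graph (or subgraph) region of `f`: the points lying between the zero axis and the
graph of `f`. -/
def graphRegion {S : Type*} (f : S → ℝ) : Set (S × ℝ) :=
  {z | (0 ≤ z.2 ∧ z.2 ≤ f z.1) ∨ (f z.1 ≤ z.2 ∧ z.2 ≤ 0)}

/-- `F` is a Vapnik-Chervonenkis graph class of functions. -/
def IsVCGraphClass {S : Type*} (F : Set (S → ℝ)) : Prop :=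
  IsVCClass (graphRegion '' F)

/-! ### Permissible classes -/

/-- Permissible classes in the sense of Pollard: `F` can be indexed, in a jointly measurable way,
by an analytic subset `T` of a compact metric space `K`, with the Borel σ-field of `T`.
(Compact metric spaces have at most the cardinality of the continuum, so it is no restriction
to take `K` in the lowest universe.) -/
def Permissible {S : Type*} [MeasurableSpace S] (F : Set (S → ℝ)) : Prop :=
  ∃ (K : Type) (_ : MetricSpace K) (_ : CompactSpace K) (_ : MeasurableSpace K)
    (_ : BorelSpace K) (T : Set K) (φ : T → S → ℝ),
    AnalyticSet T ∧ Measurable (fun z : S × T => φ z.2 z.1) ∧ Set.range φ = F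

/-! ### Classes of product functions and the conditions on them -/

/-- The product function `(s, x) ↦ h s * g x`. -/
def prodFun {U : Type*} (h : unitInterval → ℝ) (g : U → ℝ) : unitInterval × U → ℝ :=
  fun z => h z.1 * g z.2

/-- The class `H · G` of all product functions `h g` with `h ∈ H`, `g ∈ G`. -/
def prodClass {U : Type*} (H : Set (unitInterval → ℝ)) (G : Set (U → ℝ)) :
    Set (unitInterval × U → ℝ) :=
  Set.image2 prodFun H G

/-- A class of functions is uniformly bounded. -/
def UniformlyBounded {S : Type*} (F : Set (S → ℝ)) : Prop :=
  ∃ M : ℝ, ∀ f ∈ F, ∀ x, |f x| ≤ M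

/-- `H` is a uniformly bounded VC graph class of almost everywhere continuous functions
on `[0,1]`. -/
structure CondH1 (H : Set (unitInterval → ℝ)) : Prop where
  bounded : UniformlyBounded H
  vc : IsVCGraphClass H
  aeContinuous : ∀ h ∈ H, ∀ᵐ s ∂(volume : Measure unitInterval), ContinuousAt h s

/-- `G` is a VC graph class with an everywhere finite, `ν`-integrable envelope. -/
structure CondH2 {U : Type*} [MeasurableSpace U] (ν : Measure U) (G : Set (U → ℝ)) : Prop where
  vc : IsVCGraphClass G
  envelope : ∃ E : U → ℝ, Integrable E ν ∧ ∀ g ∈ G, ∀ x, |g x| ≤ E x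

/-- The "jointly VC" condition on `H · G`. -/
structure JointVC {U : Type*} [MeasurableSpace U] (ν : Measure U)
    (H : Set (unitInterval → ℝ)) (G : Set (U → ℝ)) : Prop where
  h1 : CondH1 H
  h2 : CondH2 ν G
  joint : IsVCGraphClass (prodClass H G)

/-- The "uniformly bounded, marginally VC" condition on `H · G`. -/
structure BoundedMarginalVC {U : Type*}
    (H : Set (unitInterval → ℝ)) (G : Set (U → ℝ)) : Prop where
  h1 : CondH1 H
  vc : IsVCGraphClass G
  bounded : UniformlyBounded G

/-! ### Sequential empirical measures -/

/-- For `i = 0, …, n - 1`, the point `(i + 1) / n` of `[0,1]`. -/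
def gridPoint (n : ℕ) (i : Fin n) : unitInterval :=
  ⟨((i : ℕ) + 1 : ℝ) / n, by positivity, by
    have hi : ((i : ℕ) + 1 : ℝ) ≤ n := by exact_mod_cast i.isLt
    exact div_le_one_of_le₀ hi (Nat.cast_nonneg n)⟩

/-- The uniform discrete measure `λ_n = n⁻¹ ∑_{i=1}^n δ_{i/n}` on `[0,1]`. -/
def unifDiscrete (n : ℕ) : Measure unitInterval :=
  (n : ℝ≥0∞)⁻¹ • ∑ i : Fin n, Measure.dirac (gridPoint n i)

/-- The sequential empirical measure process `ℙ_n(q) = n⁻¹ ∑_{i=1}^n q(i/n, X_i)`, evaluated at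
the sample point `ω`. The sequence is indexed from `0`: `X i` is the `(i+1)`-st observation. -/
def seqEmp {Ω U : Type*} (X : ℕ → Ω → U) (n : ℕ) (q : unitInterval × U → ℝ) (ω : Ω) : ℝ :=
  (n : ℝ)⁻¹ * ∑ i : Fin n, q (gridPoint n i, X i ω)

/-- The supremum over `f ∈ F` of `|ℙ_n(f) - ρ(f)|`, as an element of `[0,∞]`. -/
def supDev {Ω U : Type*} [MeasurableSpace U] (X : ℕ → Ω → U) (n : ℕ)
    (F : Set (unitInterval × U → ℝ)) (ρ : Measure (unitInterval × U)) (ω : Ω) : ℝ≥0∞ :=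
  ⨆ f ∈ F, ENNReal.ofReal |seqEmp X n f ω - ∫ z, f z ∂ρ|

/-- Uniform Riemann integrability: `sup_{h ∈ H} |λ_n(h) - λ(h)| → 0`. -/
def UnifRiemannIntegrable (H : Set (unitInterval → ℝ)) : Prop :=
  Tendsto (fun n : ℕ => ⨆ h ∈ H,
    ENNReal.ofReal |(∫ s, h s ∂(unifDiscrete n)) - ∫ s, h s ∂(volume : Measure unitInterval)|)
    atTop (𝓝 0)

/-- Convergence to `0` in `L_p(P)`; all the terms are required to belong to `L_p(P)`
(in particular to be measurable up to a `P`-null set). -/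
def TendstoZeroLp {Ω : Type*} [MeasurableSpace Ω] (P : Measure Ω) (p : ℝ)
    (Y : ℕ → Ω → ℝ≥0∞) : Prop :=
  (∀ n, MemLp (Y n) (ENNReal.ofReal p) P) ∧
    Tendsto (fun n => eLpNorm (Y n) (ENNReal.ofReal p) P) atTop (𝓝 0)

end SeqEmp

end

noncomputable section

namespace SeqEmp

/-! ### Analytic sets are universally measurable -/

/-! Uniformity comes from counting. On finitely many sample points, the graph regions of a bounded
VC graph class are probed at a finite grid of heights. Sauer–Shelah leaves only polynomially many
traces, and functions with equal traces are uniformly close at the sample points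
(`IsVCGraphClass.exists_cover`). Multiplying covers of the two classes gives a polynomial cover of
the products. A Rademacher sum has sub-Gaussian exponential moments, so the mean of the maximum over
the cover costs only the logarithm of its size, which is negligible against n
(`exists_rademacher_prod_majorant`).

Random signs enter by symmetrization: the mean of g is replaced by an independent copy of the sample
(Jensen), and exchanging the members of any pairs preserves the joint law. This settles bounded
classes. An integrable envelope is reduced to that case by multiplying G by the indicator of a set
where the envelope is bounded, which preserves the VC property; the rest is controlled by the tail
of the envelope. Passing from λ_n to λ costs at most sup |λ_n(h) - λ(h)| times the mean of the
envelope. For bounded classes, convergence in mean implies convergence in every L_p.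

The suprema are uncountable, so their measurability needs descriptive set theory: a superlevel set
is the projection of a measurable set along a Polish parameter space, and such projections are
measurable up to null sets because analytic sets are universally measurable. -/

/-- The sequences of natural numbers whose first `k` terms are bounded by those of `m`. -/
def initialBox (m : ℕ → ℕ) (k : ℕ) : Set (ℕ → ℕ) := {x | ∀ i < k, x i ≤ m i}

lemma initialBox_congr {m m' : ℕ → ℕ} {k : ℕ} (h : ∀ i < k, m i = m' i) :
    initialBox m k = initialBox m' k := by
  ext x
  exact forall₂_congr fun i hi => by rw [h i hi]

/-- Bounding one more coordinate by j gives images increasing in j to the original one, and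
continuity from below holds for arbitrary, possibly nonmeasurable, sets. -/
lemma exists_lt_measure_image_initialBox {α : Type*} [MeasurableSpace α] (μ : Measure α)
    (f : (ℕ → ℕ) → α) {c : ℝ≥0∞} {m : ℕ → ℕ} {k : ℕ} (h : c < μ (f '' initialBox m k)) :
    ∃ j, c < μ (f '' initialBox (Function.update m k j) (k + 1)) := by
  have hu : f '' initialBox m k =
      ⋃ j, f '' initialBox (Function.update m k j) (k + 1) := by
    rw [← Set.image_iUnion]
    congr 1
    ext x
    simp only [initialBox, Set.mem_iUnion, Set.mem_ofPred_eq]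
    constructor
    · intro hx
      refine ⟨x k, fun i hi => ?_⟩
      rcases Nat.lt_succ_iff_lt_or_eq.1 hi with hi | rfl
      · rw [Function.update_of_ne hi.ne]; exact hx i hi
      · simp
    · rintro ⟨j, hj⟩ i hi
      simpa [Function.update_of_ne hi.ne] using hj i (hi.trans (Nat.lt_succ_self k))
  have hmono : Monotone fun j => f '' initialBox (Function.update m k j) (k + 1) := by
    intro a b hab
    refine Set.image_mono fun x hx i hi => (hx i hi).trans ?_
    rcases Nat.lt_succ_iff_lt_or_eq.1 hi with hi | rfl
    · simp [Function.update_of_ne hi.ne]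
    · simpa using hab
  rw [hu, hmono.measure_iUnion] at h
  exact lt_iSup_iff.1 h

lemma exists_forall_lt_measure_image_initialBox {α : Type*} [MeasurableSpace α] (μ : Measure α)
    (f : (ℕ → ℕ) → α) {c : ℝ≥0∞} (h : c < μ (Set.range f)) :
    ∃ m : ℕ → ℕ, ∀ k, c < μ (f '' initialBox m k) := by
  let g : (k : ℕ) → {m : ℕ → ℕ // c < μ (f '' initialBox m k)} := fun k =>
    Nat.rec ⟨0, by simpa [initialBox] using h⟩
      (fun k m => ⟨Function.update m.1 k (exists_lt_measure_image_initialBox μ f m.2).choose,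
        (exists_lt_measure_image_initialBox μ f m.2).choose_spec⟩) k
  have hg : ∀ k i, i ≠ k → (g (k + 1)).1 i = (g k).1 i := fun k i hi =>
    Function.update_of_ne hi _ _
  refine ⟨fun i => (g (i + 1)).1 i, fun k => ?_⟩
  -- Stage k alters coordinate k only, so coordinate i is final from stage i + 1 on and the diagonal
  -- sequence agrees with every stage below its index.
  have : ∀ d i, (g (i + 1 + d)).1 i = (g (i + 1)).1 i := by
    intro d i
    induction d with
    | zero => rfl
    | succ d ih => rw [← ih, ← add_assoc]; exact hg _ _ (by omega)
  rw [initialBox_congr (m' := (g k).1)]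
  · exact (g k).2
  · intro i hi
    obtain ⟨d, rfl⟩ := Nat.exists_eq_add_of_le (Nat.succ_le_of_lt hi)
    exact (this d i).symm

lemma isCompact_setOf_forall_le (m : ℕ → ℕ) : IsCompact {x : ℕ → ℕ | ∀ i, x i ≤ m i} := by
  have : {x : ℕ → ℕ | ∀ i, x i ≤ m i} = Set.univ.pi fun i => Set.Iic (m i) := by
    ext; simp [Pi.le_def]
  rw [this]
  exact isCompact_univ_pi fun i => (Set.finite_Iic (m i)).isCompact

/-- Compactness: points of the boxes outside V, truncated by m, have a convergent subsequence.
Truncation leaves the first k coordinates of the k-th point unchanged, so the untruncated points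
have the same limit, which lies both in V and in its closed complement. -/
lemma exists_initialBox_subset {m : ℕ → ℕ} {V : Set (ℕ → ℕ)} (hV : IsOpen V)
    (h : {x | ∀ i, x i ≤ m i} ⊆ V) : ∃ k, initialBox m k ⊆ V := by
  by_contra! hc
  simp only [Set.not_subset] at hc
  choose x hx hxV using hc
  have hK := isCompact_setOf_forall_le m
  obtain ⟨a, ha, φ, hφ, hlim⟩ := hK.tendsto_subseq (x := fun k i => min (x k i) (m i))
    fun k i => min_le_right _ _
  have hlim' : Tendsto (x ∘ φ) atTop (𝓝 a) := by
    rw [tendsto_pi_nhds] at hlim ⊢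
    intro i
    refine (hlim i).congr' ?_
    filter_upwards [eventually_gt_atTop i] with k hk
    exact min_eq_left (hx (φ k) i (hk.trans_le (hφ.id_le k)))
  exact (hV.isClosed_compl.mem_of_tendsto hlim' (Eventually.of_forall fun k => hxV _)) (h ha)

/-- Choquet's capacitability argument: the compact set is the image of all sequences bounded by a
suitable m. -/
lemma exists_isCompact_le_measure_of_lt {α : Type*} [TopologicalSpace α] [T2Space α]
    [MeasurableSpace α] [OpensMeasurableSpace α] (μ : Measure α) [IsFiniteMeasure μ]
    {f : (ℕ → ℕ) → α} (hf : Continuous f) {c : ℝ≥0∞} (h : c < μ (Set.range f)) :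
    ∃ K, IsCompact K ∧ K ⊆ Set.range f ∧ c ≤ μ K := by
  obtain ⟨m, hm⟩ := exists_forall_lt_measure_image_initialBox μ f h
  have hK := isCompact_setOf_forall_le m
  have hfK := hK.image hf
  refine ⟨_, hfK, Set.image_subset_range _ _, ?_⟩
  -- A point off the compact image is separated from it by open sets, and some initial box is
  -- already mapped into the neighbourhood of that image.
  have hsub : ⋂ k, closure (f '' initialBox m k) ⊆ f '' {x | ∀ i, x i ≤ m i} := by
    intro y hy
    by_contra hyK
    obtain ⟨V, W, hV, hW, hKV, hyW, hd⟩ := SeparatedNhds.of_isCompact_isCompact hfK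
      (isCompact_singleton (x := y)) (Set.disjoint_singleton_right.2 hyK)
    obtain ⟨k, hk⟩ := exists_initialBox_subset (hV.preimage hf) (Set.image_subset_iff.1 hKV)
    obtain ⟨z, hzW, hz⟩ := mem_closure_iff.1 (Set.mem_iInter.1 hy k) W hW
      (hyW (Set.mem_singleton y))
    exact Set.disjoint_left.1 hd (Set.image_subset_iff.2 hk hz) hzW
  have hanti : Antitone fun k => closure (f '' initialBox m k) := fun a b hab =>
    closure_mono (Set.image_mono fun x hx i hi => hx i (hi.trans_le hab))
  have hlim := tendsto_measure_iInter_atTop (μ := μ)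
    (fun k => (isClosed_closure (s := f '' initialBox m k)).nullMeasurableSet) hanti
    ⟨0, measure_ne_top _ _⟩
  exact (ge_of_tendsto' hlim fun k => (hm k).le.trans (measure_mono subset_closure)).trans
    (measure_mono hsub)

/-- Analytic sets are universally measurable. -/
theorem nullMeasurableSet_of_analyticSet {α : Type*} [TopologicalSpace α] [T2Space α]
    [MeasurableSpace α] [OpensMeasurableSpace α] (μ : Measure α) [IsFiniteMeasure μ]
    {s : Set α} (hs : AnalyticSet s) : NullMeasurableSet s μ := by
  rw [analyticSet_iff_exists_polishSpace_range] at hs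
  rcases eq_or_ne (μ s) 0 with h0 | h0
  · exact .of_null h0
  obtain ⟨β, _, _, f, hf, rfl⟩ := hs
  have : Nonempty β := by
    by_contra hβ
    rw [not_nonempty_iff] at hβ
    simp [Set.range_eq_empty] at h0
  obtain ⟨g, hg, hgs⟩ := PolishSpace.exists_nat_nat_continuous_surjective β
  rw [← hgs.range_comp] at h0 ⊢
  -- Inner approximation: compact subsets of measure at least u n, with u n tending to the outer
  -- measure, have a measurable union that fills the set up to a null set.
  obtain ⟨u, -, hu, hlim⟩ := exists_seq_strictMono_tendsto' (pos_iff_ne_zero.2 h0)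
  choose K hK hKs huK using fun n =>
    exists_isCompact_le_measure_of_lt μ (hf.comp hg) (hu n).2
  have hm : NullMeasurableSet (⋃ n, K n) μ :=
    .iUnion fun n => (hK n).isClosed.nullMeasurableSet
  refine hm.congr (ae_eq_of_subset_of_measure_ge (Set.iUnion_subset hKs) ?_ hm
    (measure_ne_top _ _))
  exact le_of_tendsto' hlim fun n => (huK n).trans (measure_mono (Set.subset_iUnion K n))

/-! ### Measurable projections -/

/-- A measurable subset of `Ω × Z` is a preimage of a measurable subset of `(ℕ → ℕ) × Z` under a
map acting on the first coordinate only. -/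
lemma exists_eq_preimage_prodMap {Ω Z : Type*} [MeasurableSpace Ω] [MeasurableSpace Z]
    {B : Set (Ω × Z)} (hB : MeasurableSet B) :
    ∃ (e : Ω → ℕ → ℕ) (C : Set ((ℕ → ℕ) × Z)), Measurable e ∧ MeasurableSet C ∧
      B = Prod.map e id ⁻¹' C := by
  induction B, hB using MeasurableSpace.induction_on_inter
    generateFrom_prod.symm isPiSystem_prod with
  | empty => exact ⟨fun _ _ => 0, ∅, measurable_const, .empty, rfl⟩
  | basic t ht =>
    classical
    obtain ⟨a, ha, b, hb, rfl⟩ := ht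
    -- A rectangle is coded by the constant sequence 1 on its base and 0 off it.
    refine ⟨a.indicator 1, {y | y 0 = 1} ×ˢ b, ?_, ?_, ?_⟩
    · exact measurable_one.indicator ha
    · exact (measurableSet_eq_fun (measurable_pi_apply 0) measurable_const).prod hb
    · ext ⟨x, y⟩; by_cases hx : x ∈ a <;> simp [hx]
  | compl t _ ih =>
    obtain ⟨e, C, he, hC, rfl⟩ := ih
    exact ⟨e, Cᶜ, he, hC.compl, rfl⟩
  | iUnion f _ _ ih =>
    choose e C he hC hf using ih
    -- Countably many codes are merged into a single sequence through the pairing of ℕ × ℕ with ℕ.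
    refine ⟨fun ω k => e k.unpair.1 ω k.unpair.2,
      ⋃ n, Prod.map (fun y k => y (Nat.pair n k)) id ⁻¹' C n, ?_, ?_, ?_⟩
    · exact measurable_pi_lambda _ fun k => (measurable_pi_apply _).comp (he _)
    · refine .iUnion fun n => ?_
      refine Measurable.prodMap (measurable_pi_lambda _ fun k => measurable_pi_apply _)
        measurable_id (hC n)
    · rw [Set.preimage_iUnion]
      refine Set.iUnion_congr fun n => ?_
      conv_lhs => rw [hf n]
      rw [← Set.preimage_comp, Prod.map_comp_map]
      congr 1
      ext ⟨x, y⟩ <;> simp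

/-- The projection of a measurable set along a Polish space is measurable with respect to the
completion of any finite measure. -/
theorem nullMeasurableSet_image_fst {Ω Z : Type*} [MeasurableSpace Ω] [TopologicalSpace Z]
    [PolishSpace Z] [MeasurableSpace Z] [BorelSpace Z] (μ : Measure Ω) [IsFiniteMeasure μ]
    {B : Set (Ω × Z)} (hB : MeasurableSet B) : NullMeasurableSet (Prod.fst '' B) μ := by
  obtain ⟨e, C, he, hC, rfl⟩ := exists_eq_preimage_prodMap hB
  have hA : AnalyticSet (Prod.fst '' C) := hC.analyticSet.image_of_continuous continuous_fst
  have := (nullMeasurableSet_of_analyticSet (μ.map e) hA).preimage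
    (he.measurePreserving μ).quasiMeasurePreserving
  convert this using 1
  ext ω
  simp

/-- A supremum, over a Polish space, of a jointly measurable function is almost everywhere
measurable. -/
theorem aemeasurable_iSup_of_measurable {Ω Z : Type*} [MeasurableSpace Ω] [TopologicalSpace Z]
    [PolishSpace Z] [MeasurableSpace Z] [BorelSpace Z] (μ : Measure Ω) [IsFiniteMeasure μ]
    {Φ : Ω × Z → ℝ≥0∞} (hΦ : Measurable Φ) : AEMeasurable (fun ω => ⨆ z, Φ (ω, z)) μ := by
  refine NullMeasurable.aemeasurable (measurable_of_Ioi (α := ℝ≥0∞)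
    (δ := NullMeasurableSpace Ω μ) fun a => ?_)
  have : (fun ω => ⨆ z, Φ (ω, z)) ⁻¹' Set.Ioi a = Prod.fst '' (Φ ⁻¹' Set.Ioi a) := by
    ext ω
    simp [lt_iSup_iff]
  have h := nullMeasurableSet_image_fst μ (hΦ (measurableSet_Ioi (a := a)))
  exact this ▸ h

/-! ### Traces of Vapnik-Chervonenkis classes -/

lemma sum_range_choose_le (m d : ℕ) : ∑ k ∈ Finset.range d, m.choose k ≤ (m + 2) ^ d := by
  induction d with
  | zero => simp
  | succ d ih =>
    rw [Finset.sum_range_succ, pow_succ]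
    have h1 : m.choose d ≤ (m + 2) ^ d :=
      (Nat.choose_le_pow m d).trans (Nat.pow_le_pow_left (by omega) d)
    nlinarith

/-- A set family on `ι` shattering no set of `d` points has polynomially many members. -/
lemma card_le_of_not_shatters {ι : Type*} [Fintype ι] [DecidableEq ι] {𝒜 : Finset (Finset ι)}
    {d : ℕ} (h : ∀ s : Finset ι, s.card = d → ¬ 𝒜.Shatters s) :
    𝒜.card ≤ (Fintype.card ι + 2) ^ d := by
  -- Shattering passes to subsets, so every shattered set has fewer than d points; a family has at
  -- most as many members as it shatters sets.
  have hsub : 𝒜.shatterer ⊆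
      (Finset.range d).biUnion fun k => Finset.univ.powersetCard k := by
    intro s hs
    rw [Finset.mem_shatterer] at hs
    simp only [Finset.mem_biUnion, Finset.mem_range, Finset.mem_powersetCard, Finset.subset_univ,
      true_and, exists_eq_right']
    by_contra! hc
    obtain ⟨t, hts, ht⟩ := Finset.exists_subset_card_eq hc
    exact h t ht (hs.mono_right hts)
  calc 𝒜.card ≤ 𝒜.shatterer.card := Finset.card_le_card_shatterer 𝒜
    _ ≤ _ := Finset.card_le_card hsub
    _ ≤ ∑ k ∈ Finset.range d, (Finset.univ.powersetCard k : Finset (Finset ι)).card :=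
      Finset.card_biUnion_le
    _ = ∑ k ∈ Finset.range d, (Fintype.card ι).choose k := by simp
    _ ≤ _ := sum_range_choose_le _ _

/-- The traces of a Vapnik-Chervonenkis class on a finite family of points. -/
lemma card_traces_le {α ι : Type*} [Fintype ι] [DecidableEq ι] {C : Set (Set α)} {d : ℕ}
    (h : ∀ A : Finset α, A.card = d → ¬ Shatters C A) (p : ι → α) {𝒜 : Finset (Finset ι)}
    (h𝒜 : ∀ B ∈ 𝒜, ∃ S ∈ C, ∀ i, i ∈ B ↔ p i ∈ S) :
    𝒜.card ≤ (Fintype.card ι + 2) ^ d := by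
  classical
  refine card_le_of_not_shatters fun s hs hsh => ?_
  -- Indices with the same point belong to the same traces, so a shattered index set cannot contain
  -- two of them.
  have hinj : Set.InjOn p s := by
    intro i hi j hj hij
    obtain ⟨B, hB, hBi⟩ := hsh.exists_inter_eq_singleton hi
    obtain ⟨S, -, hS⟩ := h𝒜 B hB
    have hiB : i ∈ s ∩ B := by simp [hBi]
    have hjB : j ∈ s ∩ B := Finset.mem_inter.2
      ⟨hj, (hS j).2 (hij ▸ (hS i).1 (Finset.mem_inter.1 hiB).2)⟩
    rw [hBi] at hjB
    exact (Finset.mem_singleton.1 hjB).symm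
  refine h (s.image p) (by rw [Finset.card_image_of_injOn hinj, hs]) fun B hB => ?_
  obtain ⟨u, hu, hsu⟩ := hsh (Finset.filter_subset (fun i => p i ∈ B) s)
  obtain ⟨S, hSC, hS⟩ := h𝒜 u hu
  refine ⟨S, hSC, ?_⟩
  have key : ∀ i ∈ s, p i ∈ S ↔ p i ∈ B := fun i hi => by
    have := congrArg (i ∈ ·) hsu
    simpa [hi, hS i] using this
  ext y
  simp only [Finset.coe_image, Set.mem_inter_iff, Set.mem_image, Finset.mem_coe]
  constructor
  · rintro ⟨⟨i, hi, rfl⟩, hy⟩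
    exact (key i hi).1 hy
  · intro hy
    obtain ⟨i, hi, rfl⟩ : y ∈ p '' s := by simpa using hB hy
    exact ⟨⟨i, hi, rfl⟩, (key i hi).2 hy⟩

/-- Two functions bounded by `N δ`, whose graph regions contain the same points `(s, j δ)` with
`|j| ≤ N`, differ by at most `2 δ` at `s`. -/
lemma le_add_of_graphRegion {S : Type*} {f g : S → ℝ} {s : S} {δ : ℝ} (hδ : 0 < δ) {N : ℕ}
    (hf : |f s| ≤ N * δ) (hg : |g s| ≤ N * δ)
    (h : ∀ j : ℤ, |j| ≤ N → ((s, (j : ℝ) * δ) ∈ graphRegion f ↔ (s, (j : ℝ) * δ) ∈ graphRegion g)) :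
    f s ≤ g s + 2 * δ := by
  by_contra! hc
  -- A nonzero grid height strictly between the two values lies in exactly one of the regions.
  -- Height 0 is useless, since it belongs to every graph region.
  have key : ∀ j : ℤ, j ≠ 0 → g s < j * δ → j * δ < f s → False := by
    intro j hj h1 h2
    have hjN : |j| ≤ N := by
      have : |(j : ℝ) * δ| ≤ N * δ := by
        rw [abs_le] at *
        constructor <;> linarith
      rw [abs_mul, abs_of_pos hδ, mul_le_mul_iff_left₀ hδ] at this
      exact_mod_cast this
    have := h j hjN
    simp only [graphRegion, Set.mem_ofPred_eq] at this
    rcases lt_or_gt_of_ne hj with hj | hj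
    · have hneg : (j : ℝ) * δ < 0 := mul_neg_of_neg_of_pos (by exact_mod_cast hj) hδ
      rcases this.2 (Or.inr ⟨h1.le, hneg.le⟩) with h' | h' <;> linarith [h'.1, h'.2]
    · have hpos : 0 < (j : ℝ) * δ := mul_pos (by exact_mod_cast hj) hδ
      rcases this.1 (Or.inl ⟨hpos.le, h2.le⟩) with h' | h' <;> linarith [h'.1, h'.2]
  set j := ⌊g s / δ⌋ with hj
  have h1 : (j : ℝ) * δ ≤ g s := by
    rw [← le_div_iff₀ hδ]; exact Int.floor_le _
  have h2 : g s < (j + 1) * δ := by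
    rw [← div_lt_iff₀ hδ]; exact Int.lt_floor_add_one _
  -- A gap above 2δ contains two consecutive grid heights, of which at least one is nonzero.
  by_cases h0 : j + 1 = 0
  · exact key (j + 2) (by omega) (by push_cast; linarith) (by push_cast; linarith)
  · exact key (j + 1) h0 (by push_cast; linarith) (by push_cast; linarith)

/-- A uniformly bounded Vapnik-Chervonenkis graph class has, on `m` points, uniform covering
numbers that are polynomial in `m`. -/
theorem IsVCGraphClass.exists_cover {S : Type*} {F : Set (S → ℝ)} (hF : IsVCGraphClass F)
    (hb : UniformlyBounded F) {δ : ℝ} (hδ : 0 < δ) :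
    ∃ d c : ℕ, ∀ (m : ℕ) (p : Fin m → S), ∃ V : Finset (S → ℝ), ↑V ⊆ F ∧
      V.card ≤ (c * m + 2) ^ d ∧ ∀ f ∈ F, ∃ v ∈ V, ∀ i, |f (p i) - v (p i)| ≤ 2 * δ := by
  classical
  obtain ⟨d, hd⟩ := hF
  obtain ⟨M, hM⟩ := hb
  obtain ⟨N, hN⟩ := exists_nat_ge (M / δ)
  rw [div_le_iff₀ hδ] at hN
  refine ⟨d, (Finset.Icc (-N : ℤ) N).card, fun m p => ?_⟩
  let ι := Fin m × Finset.Icc (-N : ℤ) N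
  let q : ι → S × ℝ := fun i => (p i.1, ((i.2 : ℤ) : ℝ) * δ)
  let tr : (S → ℝ) → Finset ι := fun f => Finset.univ.filter fun i => q i ∈ graphRegion f
  -- One representative in F for each realized trace; 0 is a dummy value for the others.
  have hrep : ∀ B : Finset ι, ∃ v : S → ℝ, (∃ f ∈ F, tr f = B) → v ∈ F ∧ tr v = B := by
    intro B
    by_cases h : ∃ f ∈ F, tr f = B
    · exact ⟨h.choose, fun _ => h.choose_spec⟩
    · exact ⟨0, fun h' => absurd h' h⟩
  choose rep hrep using hrep
  let 𝒜 : Finset (Finset ι) := Finset.univ.filter fun B => ∃ f ∈ F, tr f = B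
  have hcard : 𝒜.card ≤ (Fintype.card ι + 2) ^ d := by
    refine card_traces_le hd q fun B hB => ?_
    obtain ⟨f, hf, rfl⟩ := (Finset.mem_filter.1 hB).2
    exact ⟨graphRegion f, Set.mem_image_of_mem _ hf, fun i => by simp [tr]⟩
  refine ⟨𝒜.image rep, ?_, ?_, fun f hf => ?_⟩
  · intro v hv
    obtain ⟨B, hB, rfl⟩ := Finset.mem_image.1 (Finset.mem_coe.1 hv)
    exact (hrep B (Finset.mem_filter.1 hB).2).1
  · refine Finset.card_image_le.trans (hcard.trans_eq ?_)
    simp only [ι, Fintype.card_prod, Fintype.card_fin, Fintype.card_coe, mul_comm]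
  · obtain ⟨hv, htr⟩ := hrep (tr f) ⟨f, hf, rfl⟩
    refine ⟨rep (tr f), Finset.mem_image_of_mem _ (by simpa [𝒜] using ⟨f, hf, rfl⟩), fun i => ?_⟩
    have hmem : ∀ j : ℤ, |j| ≤ N → ((p i, (j : ℝ) * δ) ∈ graphRegion (rep (tr f)) ↔
        (p i, (j : ℝ) * δ) ∈ graphRegion f) := by
      intro j hj
      have := congrArg (((i, ⟨j, Finset.mem_Icc.2 (abs_le.1 hj)⟩) : ι) ∈ ·) htr
      simpa [tr, q] using this
    have hf' := (hM f hf (p i)).trans hN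
    have hv' := (hM _ hv (p i)).trans hN
    rw [abs_le]
    constructor
    · linarith [le_add_of_graphRegion hδ hv' hf' hmem]
    · linarith [le_add_of_graphRegion hδ hf' hv' fun j hj => (hmem j hj).symm]

/-! ### Random signs -/

/-- The sign attached to a boolean. -/
def boolSign (b : Bool) : ℝ := cond b 1 (-1)

@[simp] lemma boolSign_true : boolSign true = 1 := rfl

@[simp] lemma boolSign_false : boolSign false = -1 := rfl

@[simp] lemma abs_boolSign (b : Bool) : |boolSign b| = 1 := by cases b <;> simp

/-- The moment generating function of a Rademacher sum is sub-Gaussian. -/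
lemma sum_exp_rademacher_le {n : ℕ} (a : Fin n → ℝ) {B : ℝ} (ha : ∀ i, |a i| ≤ B) (t : ℝ) :
    ∑ σ : Fin n → Bool, Real.exp (t * ∑ i, boolSign (σ i) * a i) ≤
      2 ^ n * Real.exp (t ^ 2 * B ^ 2 * n / 2) := by
  have h1 : ∀ σ : Fin n → Bool, Real.exp (t * ∑ i, boolSign (σ i) * a i) =
      ∏ i, Real.exp (t * (boolSign (σ i) * a i)) := fun σ => by
    rw [Finset.mul_sum, Real.exp_sum]
  have h2 : ∑ σ : Fin n → Bool, ∏ i, Real.exp (t * (boolSign (σ i) * a i)) =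
      ∏ i, ∑ b : Bool, Real.exp (t * (boolSign b * a i)) := by
    rw [Finset.prod_univ_sum, Fintype.piFinset_univ]
  simp_rw [h1]
  rw [h2]
  have h3 : ∀ i, ∑ b : Bool, Real.exp (t * (boolSign b * a i)) ≤
      2 * Real.exp (t ^ 2 * B ^ 2 / 2) := by
    intro i
    have : ∑ b : Bool, Real.exp (t * (boolSign b * a i)) = 2 * Real.cosh (t * a i) := by
      rw [Real.cosh_eq, Fintype.sum_bool]
      simp only [boolSign_true, boolSign_false]
      ring_nf
    rw [this]
    have hle : (t * a i) ^ 2 ≤ t ^ 2 * B ^ 2 := by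
      rw [mul_pow]
      exact mul_le_mul_of_nonneg_left (sq_le_sq' (abs_le.1 (ha i)).1 (abs_le.1 (ha i)).2)
        (sq_nonneg t)
    have := (Real.cosh_le_exp_half_sq (t * a i)).trans
      (Real.exp_le_exp.2 (div_le_div_of_nonneg_right hle two_pos.le))
    linarith
  calc _ ≤ ∏ _i : Fin n, 2 * Real.exp (t ^ 2 * B ^ 2 / 2) :=
        Finset.prod_le_prod (fun i _ => Finset.sum_nonneg fun b _ => (Real.exp_pos _).le)
          fun i _ => h3 i
    _ = _ := by
        rw [Finset.prod_const, Finset.card_univ, Fintype.card_fin, mul_pow, ← Real.exp_nat_mul]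
        ring_nf

/-- A maximal inequality for finitely many Rademacher sums. -/
lemma exists_rademacher_majorant {κ : Type*} {n : ℕ} (V : Finset κ) (a : κ → Fin n → ℝ) {B : ℝ}
    (ha : ∀ v ∈ V, ∀ i, |a v i| ≤ B) {t : ℝ} (ht : 0 < t) :
    ∃ R : (Fin n → Bool) → ℝ, (∀ σ, 0 ≤ R σ) ∧
      (∀ σ, ∀ v ∈ V, |∑ i, boolSign (σ i) * a v i| ≤ R σ) ∧
      ∑ σ, R σ ≤ 2 ^ n * ((Real.log (2 * (V.card + 1)) + t ^ 2 * B ^ 2 * n / 2 + 1) / t) := by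
  -- K bounds the mean over signs of the sum Z of exponentials below: the 2 accounts for ±t, and the
  -- extra 1 keeps K positive when V is empty.
  set K : ℝ := 2 * (V.card + 1) * Real.exp (t ^ 2 * B ^ 2 * n / 2) with hK
  have hc : (0 : ℝ) < 2 * (V.card + 1) := by positivity
  have hKpos : 0 < K := by positivity
  have hlogK : Real.log K = Real.log (2 * (V.card + 1)) + t ^ 2 * B ^ 2 * n / 2 := by
    rw [hK, Real.log_mul hc.ne' (Real.exp_pos _).ne', Real.log_exp]
  have hlog0 : 0 ≤ Real.log K := by
    rw [hlogK]
    refine add_nonneg (Real.log_nonneg ?_) (by positivity)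
    have : (0 : ℝ) ≤ V.card := Nat.cast_nonneg _
    linarith
  let S : (Fin n → Bool) → κ → ℝ := fun σ v => ∑ i, boolSign (σ i) * a v i
  let Z : (Fin n → Bool) → ℝ := fun σ =>
    ∑ v ∈ V, (Real.exp (t * S σ v) + Real.exp (-t * S σ v))
  have hterm : ∀ σ v, 0 ≤ Real.exp (t * S σ v) + Real.exp (-t * S σ v) := fun σ v => by positivity
  have hZ : ∀ σ, 0 ≤ Z σ := fun σ => Finset.sum_nonneg fun v _ => hterm σ v
  -- The tangent line of log at K replaces Jensen's inequality: log Z ≤ log K + Z/K - 1, and the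
  -- right side is linear in Z.
  refine ⟨fun σ => (Real.log K + Z σ / K) / t, fun σ => ?_, fun σ v hv => ?_, ?_⟩
  · have := hZ σ
    positivity
  · rw [le_div_iff₀ ht]
    have hexp : Real.exp (|S σ v| * t) ≤ Z σ := by
      refine le_trans ?_ (Finset.single_le_sum (fun v _ => hterm σ v) hv)
      rcases abs_choice (S σ v) with h | h <;> rw [h]
      · rw [mul_comm]; linarith [Real.exp_pos (-t * S σ v)]
      · rw [neg_mul, mul_comm, ← neg_mul]; linarith [Real.exp_pos (t * S σ v)]
    have hlog := Real.log_le_sub_one_of_pos (div_pos (Real.exp_pos (|S σ v| * t)) hKpos)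
    rw [Real.log_div (Real.exp_pos _).ne' hKpos.ne', Real.log_exp] at hlog
    have := div_le_div_of_nonneg_right hexp hKpos.le
    change |S σ v| * t ≤ _
    linarith
  · have hsum : ∑ σ, Z σ ≤ 2 ^ n * K := by
      rw [Finset.sum_comm]
      have hv : ∀ v ∈ V, ∑ σ, (Real.exp (t * S σ v) + Real.exp (-t * S σ v)) ≤
          2 ^ n * (2 * Real.exp (t ^ 2 * B ^ 2 * n / 2)) := by
        intro v hv
        rw [Finset.sum_add_distrib]
        have h1 := sum_exp_rademacher_le (a v) (ha v hv) t
        have h2 := sum_exp_rademacher_le (a v) (ha v hv) (-t)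
        rw [neg_sq] at h2
        linarith
      refine (Finset.sum_le_card_nsmul V _ _ hv).trans ?_
      rw [nsmul_eq_mul, hK]
      have : (0 : ℝ) < 2 ^ n * (2 * Real.exp (t ^ 2 * B ^ 2 * n / 2)) := by positivity
      nlinarith
    rw [← Finset.sum_div, Finset.sum_add_distrib, ← Finset.sum_div, ← mul_div_assoc]
    refine div_le_div_of_nonneg_right ?_ ht.le
    have hZK : (∑ σ, Z σ) / K ≤ 2 ^ n := by rwa [div_le_iff₀ hKpos]
    rw [Finset.sum_const, Finset.card_univ, nsmul_eq_mul, ← hlogK]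
    simp only [Fintype.card_pi, Fintype.card_bool, Finset.prod_const, Finset.card_univ,
      Fintype.card_fin, Nat.cast_pow, Nat.cast_ofNat]
    linarith

lemma tendsto_log_poly_div (c : ℕ) (D : ℝ) :
    Tendsto (fun n : ℕ => (D * Real.log (c * n + 2) + 1) / n) atTop (𝓝 0) := by
  have hlin : Tendsto (fun n : ℕ => ((c : ℝ) + 1) * n + 2) atTop atTop :=
    tendsto_atTop_add_const_right _ _
      (tendsto_natCast_atTop_atTop.const_mul_atTop (by positivity))
  have ho := Real.isLittleO_log_id_atTop.comp_tendsto hlin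
  have hO : (fun n : ℕ => ((c : ℝ) + 1) * n + 2) =O[atTop] fun n : ℕ => (n : ℝ) := by
    refine Asymptotics.IsBigO.of_bound ((c : ℝ) + 3) ?_
    filter_upwards [eventually_ge_atTop 1] with n hn
    have hn' : (1 : ℝ) ≤ n := by exact_mod_cast hn
    rw [Real.norm_of_nonneg (by positivity), Real.norm_of_nonneg (by positivity)]
    linarith
  have h1 := (ho.trans_isBigO hO).tendsto_div_nhds_zero
  have h2 : Tendsto (fun n : ℕ => Real.log (c * n + 2) / n) atTop (𝓝 0) := by
    refine squeeze_zero (fun n => ?_) (fun n => ?_) h1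
    · exact div_nonneg (Real.log_nonneg (by
        have : (0 : ℝ) ≤ c * n := by positivity
        linarith)) (Nat.cast_nonneg n)
    · refine div_le_div_of_nonneg_right (Real.log_le_log (by positivity) ?_) (Nat.cast_nonneg n)
      have : (0 : ℝ) ≤ n := Nat.cast_nonneg n
      nlinarith
  have h3 := (h2.const_mul D).add (tendsto_inv_atTop_nhds_zero_nat (𝕜 := ℝ))
  simp only [mul_zero, add_zero] at h3
  refine h3.congr fun n => ?_
  rw [add_div, mul_div_assoc, one_div]

lemma abs_mul_sub_sub_le {a b b' c d d' M δ : ℝ} (hδ : 0 ≤ δ) (hb : |b| ≤ M) (hb' : |b'| ≤ M)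
    (hc : |c| ≤ M) (hac : |a - c| ≤ 2 * δ) (hbd : |b - d| ≤ 2 * δ) (hbd' : |b' - d'| ≤ 2 * δ) :
    |a * (b - b') - c * (d - d')| ≤ 8 * M * δ := by
  have h1 : a * (b - b') - c * (d - d') = (a - c) * (b - b') + c * ((b - d) - (b' - d')) := by ring
  have h2 : |b - b'| ≤ 2 * M := (abs_sub _ _).trans (by linarith)
  have h3 : |(b - d) - (b' - d')| ≤ 4 * δ := (abs_sub _ _).trans (by linarith)
  rw [h1]
  refine (abs_add_le _ _).trans ?_
  rw [abs_mul, abs_mul]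
  have h4 := mul_le_mul hac h2 (abs_nonneg _) (by positivity)
  have h5 := mul_le_mul hc h3 (abs_nonneg _) ((abs_nonneg _).trans hc)
  linarith

/-- The Rademacher averages of the symmetrized products of two uniformly bounded
Vapnik-Chervonenkis graph classes tend to zero, uniformly in the sample points. -/
theorem exists_rademacher_prod_majorant {S U : Type*} {H : Set (S → ℝ)} {G : Set (U → ℝ)}
    (hH : IsVCGraphClass H) (hHb : UniformlyBounded H) (hG : IsVCGraphClass G)
    (hGb : UniformlyBounded G) {ε : ℝ} (hε : 0 < ε) :
    ∀ᶠ n : ℕ in atTop, ∀ (s : Fin n → S) (x y : Fin n → U), ∃ R : (Fin n → Bool) → ℝ,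
      (∀ σ, 0 ≤ R σ) ∧
      (∀ σ, ∀ h ∈ H, ∀ g ∈ G,
        |(n : ℝ)⁻¹ * ∑ i, boolSign (σ i) * (h (s i) * (g (x i) - g (y i)))| ≤ R σ) ∧
      ∑ σ, R σ ≤ 2 ^ n * ε := by
  obtain ⟨M, hM0, hMH, hMG⟩ : ∃ M : ℝ, 0 < M ∧ (∀ h ∈ H, ∀ z, |h z| ≤ M) ∧
      ∀ g ∈ G, ∀ z, |g z| ≤ M := by
    obtain ⟨M₁, h₁⟩ := hHb
    obtain ⟨M₂, h₂⟩ := hGb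
    refine ⟨max 1 (max M₁ M₂), by positivity, fun h hh z => (h₁ h hh z).trans (by simp),
      fun g hg z => (h₂ g hg z).trans (by simp)⟩
  -- B bounds the summands. The choice of δ makes the covering error 8Mδ equal to ε/2, and t makes
  -- the variance term ε/4, leaving ε/4 for the logarithm.
  set B : ℝ := 2 * M ^ 2 with hB
  set δ : ℝ := ε / (16 * M) with hδ
  set t : ℝ := ε / (2 * B ^ 2) with ht
  have hδ0 : 0 < δ := by positivity
  have ht0 : 0 < t := by positivity
  obtain ⟨d₁, c₁, hcov₁⟩ := hH.exists_cover hHb hδ0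
  obtain ⟨d₂, c₂, hcov₂⟩ := hG.exists_cover hGb hδ0
  set c := c₁ + 2 * c₂ with hc
  have hlim := tendsto_log_poly_div c ((d₁ + d₂ + 2 : ℕ) : ℝ)
  filter_upwards [hlim.eventually (gt_mem_nhds (show 0 < ε / 4 * t by positivity)),
    eventually_ge_atTop 1] with n hn hn1 s x y
  have hn0 : (0 : ℝ) < n := by exact_mod_cast hn1
  obtain ⟨V, hVH, hVc, hV⟩ := hcov₁ n s
  -- One cover of G must serve both samples, hence 2n points and the factor 2 in c.
  obtain ⟨W, hWG, hWc, hW⟩ := hcov₂ (n + n) (Fin.append x y)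
  let a : (S → ℝ) × (U → ℝ) → Fin n → ℝ := fun v i => v.1 (s i) * (v.2 (x i) - v.2 (y i))
  have ha : ∀ v ∈ V ×ˢ W, ∀ i, |a v i| ≤ B := by
    intro v hv i
    rw [Finset.mem_product] at hv
    have h1 := hMH _ (hVH hv.1) (s i)
    have h2 : |v.2 (x i) - v.2 (y i)| ≤ 2 * M := (abs_sub _ _).trans
      (by linarith [hMG _ (hWG hv.2) (x i), hMG _ (hWG hv.2) (y i)])
    rw [abs_mul]
    exact (mul_le_mul h1 h2 (abs_nonneg _) hM0.le).trans_eq (by rw [hB]; ring)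
  obtain ⟨R, hR0, hR, hRsum⟩ := exists_rademacher_majorant (V ×ˢ W) a ha ht0
  refine ⟨fun σ => (n : ℝ)⁻¹ * R σ + 8 * M * δ, fun σ => ?_, fun σ h hh g hg => ?_, ?_⟩
  · have := hR0 σ
    positivity
  · obtain ⟨v, hvV, hv⟩ := hV h hh
    obtain ⟨w, hwW, hw⟩ := hW g hg
    have hRσ := hR σ (v, w) (Finset.mem_product.2 ⟨hvV, hwW⟩)
    have hdiff : |∑ i, boolSign (σ i) * (h (s i) * (g (x i) - g (y i))) -
        ∑ i, boolSign (σ i) * a (v, w) i| ≤ n * (8 * M * δ) := by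
      rw [← Finset.sum_sub_distrib]
      refine (Finset.abs_sum_le_sum_abs _ _).trans ?_
      refine (Finset.sum_le_card_nsmul _ _ (8 * M * δ) fun i _ => ?_).trans_eq (by simp)
      rw [← mul_sub, abs_mul, abs_boolSign, one_mul]
      have hwx := hw (Fin.castAdd n i)
      have hwy := hw (Fin.natAdd n i)
      rw [Fin.append_left] at hwx
      rw [Fin.append_right] at hwy
      exact abs_mul_sub_sub_le hδ0.le (hMG g hg _) (hMG g hg _) (hMH v (hVH hvV) _) (hv i) hwx hwy
    rw [abs_mul, abs_of_pos (inv_pos.2 hn0)]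
    have : |∑ i, boolSign (σ i) * (h (s i) * (g (x i) - g (y i)))| ≤
        R σ + n * (8 * M * δ) := by
      have := abs_sub_abs_le_abs_sub (∑ i, boolSign (σ i) * (h (s i) * (g (x i) - g (y i))))
        (∑ i, boolSign (σ i) * a (v, w) i)
      linarith
    refine (mul_le_mul_of_nonneg_left this (inv_pos.2 hn0).le).trans_eq ?_
    field_simp
  -- The two extra powers of cn + 2, worth at least 4, absorb the factor 2 and the added 1.
  · have hcard : (2 : ℝ) * ((V ×ˢ W).card + 1) ≤ ((c : ℝ) * n + 2) ^ (d₁ + d₂ + 2) := by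
      have h1 : V.card ≤ (c * n + 2) ^ d₁ :=
        hVc.trans (Nat.pow_le_pow_left (by rw [hc]; nlinarith) _)
      have h2 : W.card ≤ (c * n + 2) ^ d₂ :=
        hWc.trans (Nat.pow_le_pow_left (by rw [hc]; nlinarith) _)
      have h3 : (V ×ˢ W).card ≤ (c * n + 2) ^ (d₁ + d₂) := by
        rw [Finset.card_product, pow_add]
        exact Nat.mul_le_mul h1 h2
      have h4 : 2 * ((V ×ˢ W).card + 1) ≤ (c * n + 2) ^ (d₁ + d₂ + 2) := by
        rw [pow_add _ (d₁ + d₂) 2]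
        have h5 : 1 ≤ (c * n + 2) ^ (d₁ + d₂) := Nat.one_le_pow _ _ (by omega)
        have h6 : 4 ≤ (c * n + 2) ^ 2 := by nlinarith [Nat.zero_le (c * n)]
        nlinarith
      exact_mod_cast h4
    have hlog : Real.log (2 * ((V ×ˢ W).card + 1)) ≤
        ((d₁ + d₂ + 2 : ℕ) : ℝ) * Real.log (c * n + 2) := by
      rw [← Real.log_pow]
      exact Real.log_le_log (by positivity) hcard
    rw [div_lt_iff₀ hn0] at hn
    rw [Finset.sum_add_distrib, ← Finset.mul_sum, Finset.sum_const, Finset.card_univ, nsmul_eq_mul]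
    simp only [Fintype.card_pi, Fintype.card_bool, Finset.prod_const, Finset.card_univ,
      Fintype.card_fin, Nat.cast_pow, Nat.cast_ofNat]
    have h8 : 8 * M * δ = ε / 2 := by rw [hδ]; field_simp; norm_num
    have hB0 : 0 < B := by positivity
    have htB : t * B ^ 2 = ε / 2 := by rw [ht]; field_simp
    have hmain : (Real.log (2 * ((V ×ˢ W).card + 1)) + t ^ 2 * B ^ 2 * n / 2 + 1) / t ≤
        n * (ε / 2) := by
      rw [div_le_iff₀ ht0]
      have : t ^ 2 * B ^ 2 * n / 2 = ε / 4 * t * n := by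
        rw [show t ^ 2 * B ^ 2 * n / 2 = (t * B ^ 2) * t * n / 2 by ring, htB]; ring
      linarith
    have hfin : (n : ℝ)⁻¹ * ∑ σ, R σ ≤ 2 ^ n * (ε / 2) := by
      rw [inv_mul_le_iff₀ hn0]
      refine hRsum.trans ((mul_le_mul_of_nonneg_left hmain (by positivity)).trans_eq ?_)
      ring
    rw [h8]
    linarith

/-! ### Measurability of suprema over permissible classes -/

lemma Permissible.measurable {S : Type*} [MeasurableSpace S] {F : Set (S → ℝ)}
    (hF : Permissible F) {f : S → ℝ} (hf : f ∈ F) : Measurable f := by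
  obtain ⟨K, _, _, _, _, T, φ, -, hφ, rfl⟩ := hF
  obtain ⟨t, rfl⟩ := hf
  exact hφ.comp (measurable_id.prodMk measurable_const)

/-- A nonempty permissible class can be indexed, measurably, by the Baire space. -/
lemma Permissible.exists_param {S : Type*} [MeasurableSpace S] {F : Set (S → ℝ)}
    (hF : Permissible F) (hne : F.Nonempty) :
    ∃ ψ : (ℕ → ℕ) → S → ℝ,
      Measurable (fun z : S × (ℕ → ℕ) => ψ z.2 z.1) ∧ Set.range ψ = F := by
  obtain ⟨K, _, _, _, _, T, φ, hT, hφ, rfl⟩ := hF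
  obtain ⟨_, t, rfl⟩ := hne
  rw [AnalyticSet] at hT
  rcases hT with rfl | ⟨f, hf, rfl⟩
  · exact t.2.elim
  refine ⟨fun z => φ ⟨f z, z, rfl⟩, ?_, ?_⟩
  · have hm : Measurable fun z : ℕ → ℕ => (⟨f z, z, rfl⟩ : Set.range f) :=
      hf.measurable.subtype_mk
    exact hφ.comp (measurable_fst.prodMk (hm.comp measurable_snd))
  · ext g
    constructor
    · rintro ⟨z, rfl⟩
      exact ⟨_, rfl⟩
    · rintro ⟨⟨_, z, rfl⟩, rfl⟩
      exact ⟨z, rfl⟩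

/-- A supremum over two permissible classes is almost everywhere measurable, if the quantity
considered is jointly measurable whenever the classes are indexed in a measurable way. -/
lemma Permissible.aemeasurable_iSup {Ω S U : Type*} [MeasurableSpace Ω] [MeasurableSpace S]
    [MeasurableSpace U] (μ : Measure Ω) [IsFiniteMeasure μ] {H : Set (S → ℝ)} {G : Set (U → ℝ)}
    (hH : Permissible H) (hG : Permissible G) (Φ : (S → ℝ) → (U → ℝ) → Ω → ℝ≥0∞)
    (hΦ : ∀ (φ : (ℕ → ℕ) → S → ℝ) (ψ : (ℕ → ℕ) → U → ℝ),
      Measurable (fun z : S × (ℕ → ℕ) => φ z.2 z.1) →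
      Measurable (fun z : U × (ℕ → ℕ) => ψ z.2 z.1) →
      Measurable fun z : Ω × (ℕ → ℕ) × (ℕ → ℕ) => Φ (φ z.2.1) (ψ z.2.2) z.1) :
    AEMeasurable (fun ω => ⨆ h ∈ H, ⨆ g ∈ G, Φ h g ω) μ := by
  rcases H.eq_empty_or_nonempty with rfl | hHne
  · simp
  rcases G.eq_empty_or_nonempty with rfl | hGne
  · simp
  obtain ⟨φ, hφ, rfl⟩ := hH.exists_param hHne
  obtain ⟨ψ, hψ, rfl⟩ := hG.exists_param hGne
  simpa only [iSup_range, iSup_prod] using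
    aemeasurable_iSup_of_measurable μ (hΦ φ ψ hφ hψ)

lemma supDev_prodClass {Ω U : Type*} [MeasurableSpace U] (X : ℕ → Ω → U) (n : ℕ)
    (H : Set (unitInterval → ℝ)) (G : Set (U → ℝ)) (ρ : Measure unitInterval) [SFinite ρ]
    (ν : Measure U) [SFinite ν] (ω : Ω) :
    supDev X n (prodClass H G) (ρ.prod ν) ω = ⨆ h ∈ H, ⨆ g ∈ G, ENNReal.ofReal
      |(n : ℝ)⁻¹ * ∑ i : Fin n, h (gridPoint n i) * g (X i ω) - (∫ s, h s ∂ρ) * ∫ x, g x ∂ν| := by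
  rw [supDev, prodClass, iSup_image2]
  simp only [seqEmp, prodFun, integral_prod_mul]

lemma measurable_integral_param {S Z : Type*} [MeasurableSpace S] [MeasurableSpace Z]
    {ψ : Z → S → ℝ} (hψ : Measurable fun z : S × Z => ψ z.2 z.1) (ρ : Measure S) [SFinite ρ] :
    Measurable fun z => ∫ s, ψ z s ∂ρ :=
  (StronglyMeasurable.integral_prod_left' (μ := ρ) hψ.stronglyMeasurable).measurable

theorem aemeasurable_supDev {Ω U : Type*} [MeasurableSpace Ω] [MeasurableSpace U]
    (P : Measure Ω) [IsFiniteMeasure P] {X : ℕ → Ω → U} (hX : ∀ i, Measurable (X i)) (n : ℕ)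
    {H : Set (unitInterval → ℝ)} {G : Set (U → ℝ)} (hH : Permissible H) (hG : Permissible G)
    (ρ : Measure unitInterval) [SFinite ρ] (ν : Measure U) [SFinite ν] :
    AEMeasurable (supDev X n (prodClass H G) (ρ.prod ν)) P := by
  have := hH.aemeasurable_iSup P hG (fun h g ω => ENNReal.ofReal
    |(n : ℝ)⁻¹ * ∑ i : Fin n, h (gridPoint n i) * g (X i ω) - (∫ s, h s ∂ρ) * ∫ x, g x ∂ν|)
    fun φ ψ hφ hψ => by
      have h1 := measurable_integral_param hφ ρ
      have h2 := measurable_integral_param hψ ν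
      refine ENNReal.measurable_ofReal.comp (continuous_abs.measurable.comp (.sub (.const_mul
        (Finset.measurable_sum _ fun i _ => .mul ?_ ?_) _) (.mul ?_ ?_)))
      · exact hφ.comp (measurable_const.prodMk measurable_snd.fst)
      · exact hψ.comp (((hX i).comp measurable_fst).prodMk measurable_snd.snd)
      · exact h1.comp measurable_snd.fst
      · exact h2.comp measurable_snd.snd
  exact this.congr (.of_forall fun ω => (supDev_prodClass X n H G ρ ν ω).symm)

lemma integral_unifDiscrete (n : ℕ) (h : unitInterval → ℝ) :
    ∫ s, h s ∂(unifDiscrete n) = (n : ℝ)⁻¹ * ∑ i, h (gridPoint n i) := by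
  rw [unifDiscrete, integral_smul_measure, integral_finsetSum_measure fun i _ =>
    integrable_dirac (by simp)]
  simp

instance (n : ℕ) : SFinite (unifDiscrete n) := by
  unfold unifDiscrete
  infer_instance

/-! ### Symmetrization -/

/-- The supremum of the weighted empirical process centred at its mean. -/
def centredDev {S U : Type*} [MeasurableSpace U] (ν : Measure U) {n : ℕ} (s : Fin n → S)
    (H : Set (S → ℝ)) (G : Set (U → ℝ)) (x : Fin n → U) : ℝ≥0∞ :=
  ⨆ h ∈ H, ⨆ g ∈ G, ENNReal.ofReal |(n : ℝ)⁻¹ * ∑ i, h (s i) * (g (x i) - ∫ u, g u ∂ν)|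

/-- The supremum of the weighted empirical process centred at an independent copy. -/
def symDev {S U : Type*} {n : ℕ} (s : Fin n → S) (H : Set (S → ℝ)) (G : Set (U → ℝ))
    (w : Fin n → U × U) : ℝ≥0∞ :=
  ⨆ h ∈ H, ⨆ g ∈ G, ENNReal.ofReal |(n : ℝ)⁻¹ * ∑ i, h (s i) * (g (w i).1 - g (w i).2)|

section

variable {S U : Type*} [MeasurableSpace S] [MeasurableSpace U] {n : ℕ} (s : Fin n → S)
  {H : Set (S → ℝ)} {G : Set (U → ℝ)}

lemma aemeasurable_centredDev (ν : Measure U) [SFinite ν] (hH : Permissible H)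
    (hG : Permissible G) (μ : Measure (Fin n → U)) [IsFiniteMeasure μ] :
    AEMeasurable (centredDev ν s H G) μ :=
  hH.aemeasurable_iSup μ hG (fun h g x => ENNReal.ofReal
    |(n : ℝ)⁻¹ * ∑ i, h (s i) * (g (x i) - ∫ u, g u ∂ν)|) fun φ ψ hφ hψ => by
      have h2 := measurable_integral_param hψ ν
      refine ENNReal.measurable_ofReal.comp (continuous_abs.measurable.comp (.const_mul
        (Finset.measurable_sum _ fun i _ => .mul ?_ (.sub ?_ ?_)) _))
      · exact hφ.comp (measurable_const.prodMk measurable_snd.fst)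
      · exact hψ.comp (f := fun z : (Fin n → U) × (ℕ → ℕ) × (ℕ → ℕ) => (z.1 i, z.2.2))
          (by fun_prop)
      · exact h2.comp measurable_snd.snd

lemma aemeasurable_symDev (hH : Permissible H) (hG : Permissible G)
    (μ : Measure (Fin n → U × U)) [IsFiniteMeasure μ] :
    AEMeasurable (symDev s H G) μ :=
  hH.aemeasurable_iSup μ hG (fun h g w => ENNReal.ofReal
    |(n : ℝ)⁻¹ * ∑ i, h (s i) * (g (w i).1 - g (w i).2)|) fun φ ψ hφ hψ => by
      refine ENNReal.measurable_ofReal.comp (continuous_abs.measurable.comp (.const_mul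
        (Finset.measurable_sum _ fun i _ => .mul ?_ (.sub ?_ ?_)) _))
      · exact hφ.comp (measurable_const.prodMk measurable_snd.fst)
      · exact hψ.comp (f := fun z : (Fin n → U × U) × (ℕ → ℕ) × (ℕ → ℕ) => ((z.1 i).1, z.2.2))
          (by fun_prop)
      · exact hψ.comp (f := fun z : (Fin n → U × U) × (ℕ → ℕ) × (ℕ → ℕ) => ((z.1 i).2, z.2.2))
          (by fun_prop)

/-- The exchange of the two components of a pair, unless `b` holds. -/
def swapUnless (U : Type*) [MeasurableSpace U] (b : Bool) : U × U ≃ᵐ U × U :=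
  bif b then MeasurableEquiv.refl (U × U) else MeasurableEquiv.prodComm

lemma measurePreserving_swapUnless (ν : Measure U) [SFinite ν] (b : Bool) :
    MeasurePreserving (swapUnless U b) (ν.prod ν) (ν.prod ν) := by
  cases b
  · exact Measure.measurePreserving_swap
  · exact MeasurePreserving.id _

lemma sub_swapUnless (g : U → ℝ) (b : Bool) (z : U × U) :
    g (swapUnless U b z).1 - g (swapUnless U b z).2 = boolSign b * (g z.1 - g z.2) := by
  cases b <;> simp [swapUnless, MeasurableEquiv.prodComm]

/-- The exchange of the components of those pairs where `σ` is false. -/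
def swapEquiv (U : Type*) [MeasurableSpace U] (σ : Fin n → Bool) :
    (Fin n → U × U) ≃ᵐ (Fin n → U × U) :=
  MeasurableEquiv.piCongrRight fun i => swapUnless U (σ i)

lemma measurePreserving_swapEquiv (ν : Measure U) [IsProbabilityMeasure ν] (σ : Fin n → Bool) :
    MeasurePreserving (swapEquiv U σ) (Measure.pi fun _ => ν.prod ν)
      (Measure.pi fun _ => ν.prod ν) :=
  measurePreserving_pi (fun _ => ν.prod ν) (fun _ => ν.prod ν)
    fun i => measurePreserving_swapUnless ν (σ i)

-- Exchanging a pair changes the sign of its difference, so swaps act as Rademacher signs.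
omit [MeasurableSpace S] in
lemma symDev_swapEquiv (σ : Fin n → Bool) (w : Fin n → U × U) :
    symDev s H G (swapEquiv U σ w) = ⨆ h ∈ H, ⨆ g ∈ G, ENNReal.ofReal |(n : ℝ)⁻¹ *
      ∑ i, boolSign (σ i) * (h (s i) * (g (w i).1 - g (w i).2))| := by
  have key : ∀ (h : S → ℝ) (g : U → ℝ) (i : Fin n),
      h (s i) * (g (swapEquiv U σ w i).1 - g (swapEquiv U σ w i).2) =
        boolSign (σ i) * (h (s i) * (g (w i).1 - g (w i).2)) := by
    intro h g i
    rw [mul_left_comm, ← sub_swapUnless]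
    rfl
  simp only [symDev, key]

/-- The mean of the symmetrized process is at most any bound for its averages over signs. -/
lemma lintegral_symDev_le (ν : Measure U) [IsProbabilityMeasure ν] (hH : Permissible H)
    (hG : Permissible G) {ε : ℝ} (hε : ∀ x y : Fin n → U, ∃ R : (Fin n → Bool) → ℝ,
      (∀ σ, 0 ≤ R σ) ∧
      (∀ σ, ∀ h ∈ H, ∀ g ∈ G,
        |(n : ℝ)⁻¹ * ∑ i, boolSign (σ i) * (h (s i) * (g (x i) - g (y i)))| ≤ R σ) ∧
      ∑ σ, R σ ≤ 2 ^ n * ε) :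
    ∫⁻ w, symDev s H G w ∂(Measure.pi fun _ => ν.prod ν) ≤ ENNReal.ofReal ε := by
  set π : Measure (Fin n → U × U) := Measure.pi fun _ => ν.prod ν
  have hD := aemeasurable_symDev s hH hG π
  -- The bound holds at each fixed w, so the majorant R need not depend measurably on the sample.
  have hpt : ∀ w, ∑ σ, symDev s H G (swapEquiv U σ w) ≤ ENNReal.ofReal (2 ^ n * ε) := by
    intro w
    obtain ⟨R, hR0, hR, hRs⟩ := hε (fun i => (w i).1) fun i => (w i).2
    refine le_trans (Finset.sum_le_sum fun σ _ => ?_)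
      ((ENNReal.ofReal_sum_of_nonneg fun σ _ => hR0 σ).symm.le.trans
        (ENNReal.ofReal_le_ofReal hRs))
    rw [symDev_swapEquiv]
    exact iSup₂_le fun h hh => iSup₂_le fun g hg => ENNReal.ofReal_le_ofReal (hR σ h hh g hg)
  have hsum : (2 : ℝ≥0∞) ^ n * ∫⁻ w, symDev s H G w ∂π ≤ ENNReal.ofReal (2 ^ n * ε) := by
    calc (2 : ℝ≥0∞) ^ n * ∫⁻ w, symDev s H G w ∂π
        = ∑ σ : Fin n → Bool, ∫⁻ w, symDev s H G (swapEquiv U σ w) ∂π := by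
          rw [Finset.sum_congr rfl fun σ _ => (measurePreserving_swapEquiv ν σ).lintegral_comp_emb
            (swapEquiv U σ).measurableEmbedding _]
          simp [π]
      _ = ∫⁻ w, ∑ σ : Fin n → Bool, symDev s H G (swapEquiv U σ w) ∂π :=
          (lintegral_finsetSum' _ fun σ _ => hD.comp_quasiMeasurePreserving
            (measurePreserving_swapEquiv ν σ).quasiMeasurePreserving).symm
      _ ≤ ∫⁻ _, ENNReal.ofReal (2 ^ n * ε) ∂π := lintegral_mono hpt
      _ = _ := by simp [π]
  rw [ENNReal.ofReal_mul (by positivity), ENNReal.ofReal_pow (by norm_num),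
    ENNReal.ofReal_ofNat] at hsum
  exact (ENNReal.mul_le_mul_iff_right (by simp) (by simp)).1 hsum

-- Jensen's inequality: the mean of g is the integral of g over each coordinate of the independent
-- copy.
omit [MeasurableSpace S] in
lemma centredDev_le_lintegral_symDev (ν : Measure U) [IsProbabilityMeasure ν]
    (hG : ∀ g ∈ G, Integrable g ν) (x : Fin n → U) :
    centredDev ν s H G x ≤
      ∫⁻ y, symDev s H G (fun i => (x i, y i)) ∂(Measure.pi fun _ => ν) := by
  refine iSup₂_le fun h hh => iSup₂_le fun g hg => ?_
  have hint : ∀ i : Fin n, Integrable (fun y : Fin n → U => g (y i)) (Measure.pi fun _ => ν) :=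
    fun i => (measurePreserving_eval (fun _ : Fin n => ν) i).integrable_comp_of_integrable
      (hG g hg)
  have hval : ∀ i : Fin n, ∫ y : Fin n → U, g (y i) ∂(Measure.pi fun _ => ν) = ∫ u, g u ∂ν := by
    intro i
    have hmp := measurePreserving_eval (fun _ : Fin n => ν) i
    conv_rhs => rw [← hmp.map_eq]
    rw [integral_map hmp.measurable.aemeasurable
      (by rw [hmp.map_eq]; exact (hG g hg).aestronglyMeasurable)]
  have heq : (n : ℝ)⁻¹ * ∑ i, h (s i) * (g (x i) - ∫ u, g u ∂ν) =
      ∫ y, (n : ℝ)⁻¹ * ∑ i, h (s i) * (g (x i) - g (y i)) ∂(Measure.pi fun _ : Fin n => ν) := by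
    rw [integral_const_mul, integral_finsetSum]
    · congr 1
      refine Finset.sum_congr rfl fun i _ => ?_
      rw [integral_const_mul, integral_sub (integrable_const _) (hint i), hval i]
      simp
    · exact fun i _ => ((integrable_const _).sub (hint i)).const_mul _
  rw [heq, ← Real.enorm_eq_ofReal_abs]
  refine (enorm_integral_le_lintegral_enorm _).trans (lintegral_mono fun y => ?_)
  rw [Real.enorm_eq_ofReal_abs]
  exact le_iSup₂_of_le h hh (le_iSup₂_of_le g hg le_rfl)

lemma lintegral_centredDev_le (ν : Measure U) [IsProbabilityMeasure ν] (hH : Permissible H)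
    (hG : Permissible G) (hGi : ∀ g ∈ G, Integrable g ν) :
    ∫⁻ x, centredDev ν s H G x ∂(Measure.pi fun _ => ν) ≤
      ∫⁻ w, symDev s H G w ∂(Measure.pi fun _ => ν.prod ν) := by
  have hmp := measurePreserving_arrowProdEquivProdArrow U U (Fin n) (fun _ => ν) fun _ => ν
  have hD := aemeasurable_symDev s hH hG (Measure.pi fun _ => ν.prod ν)
  have heq : ∫⁻ w, symDev s H G w ∂(Measure.pi fun _ => ν.prod ν) =
      ∫⁻ z : (Fin n → U) × (Fin n → U), symDev s H G (fun i => (z.1 i, z.2 i))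
        ∂((Measure.pi fun _ => ν).prod (Measure.pi fun _ => ν)) := by
    rw [← hmp.lintegral_comp_emb (MeasurableEquiv.measurableEmbedding _)]
    rfl
  rw [heq, lintegral_prod]
  · exact lintegral_mono fun x => centredDev_le_lintegral_symDev s ν hGi x
  · exact hD.comp_quasiMeasurePreserving (hmp.symm _).quasiMeasurePreserving

end

/-- The mean of the supremum of the sequential empirical process, for two uniformly bounded
Vapnik-Chervonenkis graph classes. -/
theorem tendsto_lintegral_supDev_of_bounded {Ω U : Type*} [MeasurableSpace Ω] [MeasurableSpace U]
    (P : Measure Ω) [IsProbabilityMeasure P] (ν : Measure U) [IsProbabilityMeasure ν]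
    {X : ℕ → Ω → U} (hX : ∀ i, Measurable (X i)) (hindep : iIndepFun X P)
    (hlaw : ∀ i, P.map (X i) = ν) {H : Set (unitInterval → ℝ)} {G : Set (U → ℝ)}
    (hH : Permissible H) (hG : Permissible G) (hHvc : IsVCGraphClass H)
    (hHb : UniformlyBounded H) (hGvc : IsVCGraphClass G) (hGb : UniformlyBounded G) :
    Tendsto (fun n => ∫⁻ ω, supDev X n (prodClass H G) ((unifDiscrete n).prod ν) ω ∂P)
      atTop (𝓝 0) := by
  have hGi : ∀ g ∈ G, Integrable g ν := by
    intro g hg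
    obtain ⟨M, hM⟩ := hGb
    exact .of_bound (hG.measurable hg).aestronglyMeasurable M (.of_forall fun x => hM g hg x)
  rw [ENNReal.tendsto_nhds_zero]
  intro ε hε
  obtain ⟨ε', hε', hle⟩ : ∃ ε' : ℝ, 0 < ε' ∧ ENNReal.ofReal ε' ≤ ε := by
    obtain ⟨r, hr0, hr⟩ := ENNReal.lt_iff_exists_nnreal_btwn.1 hε
    exact ⟨r, by exact_mod_cast hr0, by simpa using hr.le⟩
  filter_upwards [exists_rademacher_prod_majorant hHvc hHb hGvc hGb hε'] with n hn
  have hmeas : Measurable fun ω (i : Fin n) => X i ω := measurable_pi_lambda _ fun i => hX i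
  have hmap : P.map (fun ω (i : Fin n) => X i ω) = Measure.pi fun _ => ν := by
    rw [(iIndepFun_iff_map_fun_eq_pi_map fun i : Fin n => (hX i).aemeasurable).1
      (hindep.precomp Fin.val_injective)]
    simp only [hlaw]
  have heq : ∀ ω, supDev X n (prodClass H G) ((unifDiscrete n).prod ν) ω =
      centredDev ν (gridPoint n) H G fun i => X i ω := by
    intro ω
    rw [supDev_prodClass]
    unfold centredDev
    congr! 7 with h hh g hg
    rw [integral_unifDiscrete, mul_assoc, ← mul_sub, Finset.sum_mul, ← Finset.sum_sub_distrib]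
    simp only [mul_sub]
  calc ∫⁻ ω, supDev X n (prodClass H G) ((unifDiscrete n).prod ν) ω ∂P
      = ∫⁻ x, centredDev ν (gridPoint n) H G x ∂(Measure.pi fun _ => ν) := by
        simp_rw [heq]
        rw [← hmap, lintegral_map' _ hmeas.aemeasurable]
        exact aemeasurable_centredDev _ ν hH hG _
    _ ≤ ∫⁻ w, symDev (gridPoint n) H G w ∂(Measure.pi fun _ => ν.prod ν) :=
        lintegral_centredDev_le _ ν hH hG hGi
    _ ≤ ENNReal.ofReal ε' := lintegral_symDev_le _ ν hH hG (hn (gridPoint n))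
    _ ≤ ε := hle

/-! ### Truncation -/

lemma Permissible.indicator {S : Type*} [MeasurableSpace S] {F : Set (S → ℝ)}
    (hF : Permissible F) {A : Set S} (hA : MeasurableSet A) : Permissible (A.indicator '' F) := by
  obtain ⟨K, _, _, _, _, T, φ, hT, hφ, rfl⟩ := hF
  refine ⟨K, _, ‹_›, _, ‹_›, T, fun t => A.indicator (φ t), hT, ?_, ?_⟩
  · convert hφ.indicator (hA.prod MeasurableSet.univ) using 1
    ext ⟨x, t⟩
    by_cases hx : x ∈ A <;> simp [hx]
  · rw [← Set.range_comp]
    rfl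

/-- Off A, membership in a region does not depend on the function, so a shattered set lies over A,
where truncation changes nothing. The same d therefore works. -/
lemma IsVCGraphClass.indicator {S : Type*} {F : Set (S → ℝ)} (hF : IsVCGraphClass F)
    (A : Set S) : IsVCGraphClass (A.indicator '' F) := by
  obtain ⟨d, hd⟩ := hF
  have key : ∀ (f : S → ℝ) (z : S × ℝ), z ∈ graphRegion (A.indicator f) ↔
      (z.1 ∈ A ∧ z ∈ graphRegion f) ∨ (z.1 ∉ A ∧ z.2 = 0) := by
    intro f z
    by_cases hz : z.1 ∈ A
    · simp [graphRegion, hz]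
    · simp only [graphRegion, Set.mem_ofPred_eq, Set.indicator_of_notMem hz, hz, false_and,
        not_false_eq_true, true_and, false_or]
      constructor
      · rintro (h | h) <;> linarith [h.1, h.2]
      · intro h; simp [h]
  refine ⟨d, fun B hB hsh => hd B hB ?_⟩
  have hBA : ∀ z ∈ B, z.1 ∈ A := by
    intro z hz
    by_contra hzA
    obtain ⟨_, ⟨_, ⟨f, -, rfl⟩, rfl⟩, h₁⟩ := hsh ∅ (Set.empty_subset _)
    obtain ⟨_, ⟨_, ⟨g, -, rfl⟩, rfl⟩, h₂⟩ := hsh B subset_rfl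
    have h1 : z ∉ graphRegion (A.indicator f) := fun h => by
      have : z ∈ (∅ : Set (S × ℝ)) := h₁ ▸ ⟨hz, h⟩
      exact this
    have h2 : z ∈ graphRegion (A.indicator g) := (h₂.ge (Finset.mem_coe.2 hz)).2
    rw [key] at h1 h2
    tauto
  intro C hC
  obtain ⟨_, ⟨_, ⟨f, hf, rfl⟩, rfl⟩, h⟩ := hsh C hC
  refine ⟨_, Set.mem_image_of_mem _ hf, ?_⟩
  rw [← h]
  ext z
  simp only [Set.mem_inter_iff, Finset.mem_coe, key]
  have := hBA z
  tauto

lemma exists_truncation {U : Type*} [MeasurableSpace U] {ν : Measure U} {E : U → ℝ}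
    (hE : Integrable E ν) {η : ℝ} (hη : 0 < η) :
    ∃ (A : Set U) (L : ℝ), MeasurableSet A ∧ (∀ x ∈ A, E x ≤ L) ∧
      ∫⁻ x in Aᶜ, ‖E x‖ₑ ∂ν ≤ ENNReal.ofReal η := by
  obtain ⟨E', hE'm, hE'⟩ := hE.aestronglyMeasurable
  have hE'i : Integrable E' ν := hE.congr hE'
  obtain ⟨M, hM⟩ := (memLp_one_iff_integrable.2 hE'i).integral_indicator_norm_ge_le hE'm hη
  simp only [coe_nnnorm] at hM
  -- E is only almost everywhere measurable; outside the measurable null set N it agrees with a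
  -- measurable version, which is then cut at height M.
  set N := toMeasurable ν {x | E x ≠ E' x} with hN
  have hN0 : ν N = 0 := by rw [hN, measure_toMeasurable]; exact hE'
  have hsub : ∀ x ∉ N, E x = E' x := fun x hx => by
    by_contra h
    exact hx (subset_toMeasurable _ _ h)
  have hmM : MeasurableSet {x | M ≤ ‖E' x‖} :=
    measurableSet_le measurable_const hE'm.measurable.norm
  refine ⟨{x | M ≤ ‖E' x‖}ᶜ ∩ Nᶜ, M, hmM.compl.inter (measurableSet_toMeasurable _ _).compl,
    fun x hx => ?_, ?_⟩
  · rw [hsub x hx.2]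
    exact (le_abs_self _).trans (le_of_not_ge fun h => hx.1 h)
  · have hAm := (hmM.compl.inter (measurableSet_toMeasurable ν {x | E x ≠ E' x}).compl).compl
    rw [← hN] at hAm
    rw [← lintegral_indicator hAm]
    refine (lintegral_mono_ae ?_).trans hM
    have : ∀ᵐ x ∂ν, x ∉ N := measure_eq_zero_iff_ae_notMem.1 hN0
    filter_upwards [this] with x hx
    by_cases hxM : M ≤ ‖E' x‖
    · rw [Set.indicator_of_mem (show x ∈ {x | M ≤ ‖E' x‖} from hxM), ← hsub x hx]
      exact Set.indicator_le_self _ _ _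
    · rw [Set.indicator_of_notMem]
      · exact zero_le
      · simpa [hx] using not_le.1 hxM

lemma enorm_le_of_abs_le {a M : ℝ} (h : |a| ≤ M) : ‖a‖ₑ ≤ ENNReal.ofReal M := by
  rw [Real.enorm_eq_ofReal_abs]
  exact ENNReal.ofReal_le_ofReal h

/-- Truncation changes the supremum of the deviations by at most the mean of the tail of an
envelope, under the empirical measure and under the law of the observations. -/
lemma supDev_le_supDev_indicator_add {Ω U : Type*} [MeasurableSpace U] (X : ℕ → Ω → U) (n : ℕ)
    {H : Set (unitInterval → ℝ)} {G : Set (U → ℝ)} (ρ : Measure unitInterval) [SFinite ρ]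
    (ν : Measure U) [SFinite ν] {M : ℝ} (hH : ∀ h ∈ H, ∀ s, |h s| ≤ M)
    (hρ : ∀ h ∈ H, |∫ s, h s ∂ρ| ≤ M) {E : U → ℝ} (hG : ∀ g ∈ G, Integrable g ν)
    (hE : ∀ g ∈ G, ∀ x, |g x| ≤ E x) {A : Set U} (hA : MeasurableSet A) (ω : Ω) :
    supDev X n (prodClass H G) (ρ.prod ν) ω ≤
      supDev X n (prodClass H (A.indicator '' G)) (ρ.prod ν) ω +
        ENNReal.ofReal M * ((n : ℝ≥0∞)⁻¹ * ∑ i : Fin n, Aᶜ.indicator (fun x => ‖E x‖ₑ) (X i ω) +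
          ∫⁻ x in Aᶜ, ‖E x‖ₑ ∂ν) := by
  rw [supDev_prodClass, supDev_prodClass]
  refine iSup₂_le fun h hh => iSup₂_le fun g hg => ?_
  have hgE : ∀ x, ‖g x‖ₑ ≤ ‖E x‖ₑ := fun x => by
    rw [Real.enorm_eq_ofReal_abs, Real.enorm_eq_ofReal_abs]
    exact ENNReal.ofReal_le_ofReal ((hE g hg x).trans (le_abs_self _))
  have hdec : (n : ℝ)⁻¹ * ∑ i : Fin n, h (gridPoint n i) * g (X i ω) -
      (∫ s, h s ∂ρ) * ∫ x, g x ∂ν =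
      ((n : ℝ)⁻¹ * ∑ i : Fin n, h (gridPoint n i) * A.indicator g (X i ω) -
        (∫ s, h s ∂ρ) * ∫ x, A.indicator g x ∂ν) +
      ((n : ℝ)⁻¹ * ∑ i : Fin n, h (gridPoint n i) * Aᶜ.indicator g (X i ω) -
        (∫ s, h s ∂ρ) * ∫ x in Aᶜ, g x ∂ν) := by
    rw [integral_indicator hA, ← integral_add_compl hA (hG g hg)]
    have : ∀ i : Fin n, h (gridPoint n i) * g (X i ω) =
        h (gridPoint n i) * A.indicator g (X i ω) +
          h (gridPoint n i) * Aᶜ.indicator g (X i ω) := fun i => by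
      rw [← mul_add, Set.indicator_self_add_compl_apply]
    rw [Finset.sum_congr rfl fun i _ => this i, Finset.sum_add_distrib]
    ring
  rw [hdec, ← Real.enorm_eq_ofReal_abs]
  refine (enorm_add_le _ _).trans (add_le_add ?_ ?_)
  · rw [Real.enorm_eq_ofReal_abs]
    exact le_iSup₂_of_le h hh (le_iSup₂_of_le (A.indicator g) (Set.mem_image_of_mem _ hg) le_rfl)
  · refine (enorm_sub_le).trans ?_
    rw [mul_add, enorm_mul, enorm_mul]
    refine add_le_add ?_ (mul_le_mul' (enorm_le_of_abs_le (hρ h hh))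
      ((enorm_integral_le_lintegral_enorm _).trans (lintegral_mono fun x => hgE x)))
    rw [mul_left_comm, Finset.mul_sum]
    refine mul_le_mul' ?_ ((enorm_sum_le _ _).trans (Finset.sum_le_sum fun i _ => ?_))
    -- At n = 0 the real inverse is 0 and the extended one is ∞.
    · rcases Nat.eq_zero_or_pos n with rfl | hn
      · simp
      · rw [enorm_inv (by positivity)]
        simp
    · rw [enorm_mul, enorm_indicator_eq_indicator_enorm]
      exact mul_le_mul' (enorm_le_of_abs_le (hH h hh _))
        (Set.indicator_le_indicator (hgE _))

lemma abs_integral_unifDiscrete_le {n : ℕ} {h : unitInterval → ℝ} {M : ℝ}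
    (hM : ∀ s, |h s| ≤ M) : |∫ s, h s ∂(unifDiscrete n)| ≤ M := by
  rw [integral_unifDiscrete, abs_mul, abs_of_nonneg (by positivity)]
  rcases Nat.eq_zero_or_pos n with rfl | hn
  · simpa using (abs_nonneg _).trans (hM 0)
  · rw [inv_mul_le_iff₀ (by positivity)]
    refine (Finset.abs_sum_le_sum_abs _ _).trans ?_
    exact (Finset.sum_le_card_nsmul _ _ M fun i _ => hM _).trans_eq (by simp)

lemma inv_mul_le_of_le_nsmul {n : ℕ} {a b : ℝ≥0∞} (h : a ≤ n • b) :
    (n : ℝ≥0∞)⁻¹ * a ≤ b := by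
  rcases Nat.eq_zero_or_pos n with rfl | hn
  · simp_all
  · rw [nsmul_eq_mul] at h
    calc (n : ℝ≥0∞)⁻¹ * a ≤ (n : ℝ≥0∞)⁻¹ * (n * b) := by gcongr
      _ = b := by
        rw [← mul_assoc, ENNReal.inv_mul_cancel (by simpa using hn.ne') (by simp), one_mul]

lemma lintegral_inv_mul_sum_comp_le {Ω U : Type*} [MeasurableSpace Ω] [MeasurableSpace U]
    {P : Measure Ω} {ν : Measure U} {X : ℕ → Ω → U} (hX : ∀ i, Measurable (X i))
    (hlaw : ∀ i, P.map (X i) = ν) (n : ℕ) {f : U → ℝ≥0∞} (hf : AEMeasurable f ν) :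
    ∫⁻ ω, (n : ℝ≥0∞)⁻¹ * ∑ i : Fin n, f (X i ω) ∂P ≤ ∫⁻ x, f x ∂ν := by
  have hfX : ∀ i, AEMeasurable (fun ω => f (X i ω)) P := fun i =>
    AEMeasurable.comp_measurable (by rwa [hlaw]) (hX i)
  have hint : ∀ i, ∫⁻ ω, f (X i ω) ∂P = ∫⁻ x, f x ∂ν := fun i => by
    rw [← hlaw i, lintegral_map' (by rwa [hlaw]) (hX i).aemeasurable]
  rw [lintegral_const_mul'' _ (Finset.aemeasurable_fun_sum _ fun (i : Fin n) _ => hfX i),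
    lintegral_finsetSum' _ fun (i : Fin n) _ => hfX i]
  refine inv_mul_le_of_le_nsmul ?_
  simp [hint]

/-- Integrated form of the truncation inequality. -/
lemma lintegral_supDev_le_add {Ω U : Type*} [MeasurableSpace Ω] [MeasurableSpace U]
    {P : Measure Ω} {ν : Measure U} [SFinite ν] {X : ℕ → Ω → U} (hX : ∀ i, Measurable (X i))
    (hlaw : ∀ i, P.map (X i) = ν) (n : ℕ)
    {H : Set (unitInterval → ℝ)} {G : Set (U → ℝ)} (ρ : Measure unitInterval) [SFinite ρ]
    {M : ℝ} (hH : ∀ h ∈ H, ∀ s, |h s| ≤ M)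
    (hρ : ∀ h ∈ H, |∫ s, h s ∂ρ| ≤ M) {E : U → ℝ} (hEi : Integrable E ν)
    (hG : ∀ g ∈ G, Integrable g ν) (hE : ∀ g ∈ G, ∀ x, |g x| ≤ E x) {A : Set U}
    (hA : MeasurableSet A) :
    ∫⁻ ω, supDev X n (prodClass H G) (ρ.prod ν) ω ∂P ≤
      ∫⁻ ω, supDev X n (prodClass H (A.indicator '' G)) (ρ.prod ν) ω ∂P +
        ENNReal.ofReal M * (∫⁻ x in Aᶜ, ‖E x‖ₑ ∂ν + P Set.univ * ∫⁻ x in Aᶜ, ‖E x‖ₑ ∂ν) := by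
  have hf : AEMeasurable (Aᶜ.indicator fun x => ‖E x‖ₑ) ν :=
    hEi.aestronglyMeasurable.enorm.indicator hA.compl
  have hfX : ∀ i, AEMeasurable (fun ω => Aᶜ.indicator (fun x => ‖E x‖ₑ) (X i ω)) P := fun i =>
    AEMeasurable.comp_measurable (g := Aᶜ.indicator fun x => ‖E x‖ₑ) (by rwa [hlaw]) (hX i)
  have hm : AEMeasurable (fun ω => (n : ℝ≥0∞)⁻¹ *
      ∑ i : Fin n, Aᶜ.indicator (fun x => ‖E x‖ₑ) (X i ω)) P :=
    (Finset.aemeasurable_fun_sum _ fun (i : Fin n) _ => hfX i).const_mul _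
  refine (lintegral_mono (supDev_le_supDev_indicator_add X n ρ ν hH hρ hG hE hA)).trans ?_
  rw [lintegral_add_right' _ ((hm.add_const _).const_mul _),
    lintegral_const_mul'' _ (hm.add_const _), lintegral_add_left' hm, lintegral_const,
    mul_comm _ (P Set.univ)]
  gcongr
  refine (lintegral_inv_mul_sum_comp_le hX hlaw n hf).trans_eq ?_
  rw [lintegral_indicator hA.compl]

/-! ### Convergence in mean -/

section

variable {Ω U : Type*} [MeasurableSpace Ω] [MeasurableSpace U]
  (P : Measure Ω) [IsProbabilityMeasure P] (ν : Measure U) [IsProbabilityMeasure ν]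
  {X : ℕ → Ω → U} (hX : ∀ i, Measurable (X i))
  (hlaw : ∀ i, P.map (X i) = ν) {H : Set (unitInterval → ℝ)} {G : Set (U → ℝ)}

include hX hlaw

/-- Truncation to the empty set leaves only the envelope terms, which are finite. -/
lemma lintegral_supDev_lt_top {M : ℝ} (hH : ∀ h ∈ H, ∀ s, |h s| ≤ M)
    (ρ : Measure unitInterval) [SFinite ρ] (hρ : ∀ h ∈ H, |∫ s, h s ∂ρ| ≤ M)
    {E : U → ℝ} (hEi : Integrable E ν) (hG : Permissible G) (hE : ∀ g ∈ G, ∀ x, |g x| ≤ E x)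
    (n : ℕ) : ∫⁻ ω, supDev X n (prodClass H G) (ρ.prod ν) ω ∂P < ⊤ := by
  have hGi : ∀ g ∈ G, Integrable g ν := fun g hg =>
    hEi.mono' (hG.measurable hg).aestronglyMeasurable (.of_forall fun x => hE g hg x)
  refine (lintegral_supDev_le_add hX hlaw n ρ hH hρ hEi hGi hE MeasurableSet.empty).trans_lt ?_
  have h0 : ∀ ω, supDev X n (prodClass H ((∅ : Set U).indicator '' G)) (ρ.prod ν) ω = 0 := by
    intro ω
    rw [supDev_prodClass]
    simp
  have hEfin : ∫⁻ x, ‖E x‖ₑ ∂ν < ⊤ := hEi.2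
  simp only [h0, lintegral_zero, zero_add, Set.compl_empty, Measure.restrict_univ, measure_univ,
    one_mul]
  exact ENNReal.mul_lt_top ENNReal.ofReal_lt_top (ENNReal.add_lt_top.2 ⟨hEfin, hEfin⟩)

/-- A Vapnik-Chervonenkis graph class with an integrable envelope, weighted by a uniformly bounded
one: uniform law of large numbers in mean. -/
theorem tendsto_lintegral_supDev (hindep : iIndepFun X P) (hH : Permissible H)
    (hG : Permissible G) (hHb : UniformlyBounded H) (hHvc : IsVCGraphClass H)
    (hGvc : IsVCGraphClass G) {E : U → ℝ} (hEi : Integrable E ν)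
    (hE : ∀ g ∈ G, ∀ x, |g x| ≤ E x) :
    Tendsto (fun n => ∫⁻ ω, supDev X n (prodClass H G) ((unifDiscrete n).prod ν) ω ∂P)
      atTop (𝓝 0) := by
  have hGi : ∀ g ∈ G, Integrable g ν := fun g hg =>
    hEi.mono' (hG.measurable hg).aestronglyMeasurable (.of_forall fun x => hE g hg x)
  obtain ⟨M, hM0, hM⟩ : ∃ M : ℝ, 0 < M ∧ ∀ h ∈ H, ∀ s, |h s| ≤ M := by
    obtain ⟨M, hM⟩ := hHb
    exact ⟨max 1 M, by positivity, fun h hh s => (hM h hh s).trans (le_max_right _ _)⟩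
  rw [ENNReal.tendsto_nhds_zero]
  intro ε hε
  obtain ⟨r, hr0, hr⟩ := ENNReal.lt_iff_exists_nnreal_btwn.1 hε
  have hr0' : (0 : ℝ) < r := by exact_mod_cast hr0
  -- The tail is counted twice with weight M, so it contributes r/2 in all.
  obtain ⟨A, L, hA, hL, hη⟩ := exists_truncation hEi
    (show 0 < (r : ℝ) / (4 * M) by positivity)
  have hlim := tendsto_lintegral_supDev_of_bounded P ν hX hindep hlaw hH (hG.indicator hA) hHvc
    hHb (hGvc.indicator A) ⟨max 0 L, by
      rintro _ ⟨g, hg, rfl⟩ x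
      by_cases hx : x ∈ A
      · rw [Set.indicator_of_mem hx]
        exact (hE g hg x).trans ((hL x hx).trans (le_max_right _ _))
      · simp [hx]⟩
  rw [ENNReal.tendsto_nhds_zero] at hlim
  filter_upwards [hlim (ENNReal.ofReal ((r : ℝ) / 2)) (by simpa using hr0')] with n hn
  refine (lintegral_supDev_le_add hX hlaw n _ hM
    (fun h hh => abs_integral_unifDiscrete_le (hM h hh)) hEi hGi hE hA).trans ?_
  rw [measure_univ, one_mul]
  calc _ ≤ ENNReal.ofReal ((r : ℝ) / 2) + ENNReal.ofReal M *
        (ENNReal.ofReal ((r : ℝ) / (4 * M)) + ENNReal.ofReal ((r : ℝ) / (4 * M))) := by gcongr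
    _ = ENNReal.ofReal r := by
        rw [← ENNReal.ofReal_add (by positivity) (by positivity),
          ← ENNReal.ofReal_mul hM0.le, ← ENNReal.ofReal_add (by positivity) (by positivity)]
        congr 1
        field_simp
        norm_num
    _ ≤ ε := by simpa using hr.le

end

lemma supDev_volume_le {Ω U : Type*} [MeasurableSpace U] (X : ℕ → Ω → U) (n : ℕ)
    {H : Set (unitInterval → ℝ)} {G : Set (U → ℝ)} (ν : Measure U) [SFinite ν] {E : U → ℝ}
    (hE : ∀ g ∈ G, ∀ x, |g x| ≤ E x) (ω : Ω) :
    supDev X n (prodClass H G) ((volume : Measure unitInterval).prod ν) ω ≤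
      supDev X n (prodClass H G) ((unifDiscrete n).prod ν) ω +
        (⨆ h ∈ H, ENNReal.ofReal |(∫ s, h s ∂(unifDiscrete n)) -
          ∫ s, h s ∂(volume : Measure unitInterval)|) * ∫⁻ x, ‖E x‖ₑ ∂ν := by
  rw [supDev_prodClass, supDev_prodClass]
  refine iSup₂_le fun h hh => iSup₂_le fun g hg => ?_
  have hdec : ∀ a b c d : ℝ, a - b * c = (a - d * c) + (d - b) * c := by intros; ring
  rw [hdec _ _ _ (∫ s, h s ∂(unifDiscrete n)), ← Real.enorm_eq_ofReal_abs]
  refine (enorm_add_le _ _).trans (add_le_add ?_ ?_)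
  · rw [Real.enorm_eq_ofReal_abs]
    exact le_iSup₂_of_le h hh (le_iSup₂_of_le g hg le_rfl)
  · rw [enorm_mul, Real.enorm_eq_ofReal_abs]
    refine mul_le_mul' (le_iSup₂_of_le h hh le_rfl)
      ((enorm_integral_le_lintegral_enorm _).trans (lintegral_mono fun x => ?_))
    rw [Real.enorm_eq_ofReal_abs, Real.enorm_eq_ofReal_abs]
    exact ENNReal.ofReal_le_ofReal ((hE g hg x).trans (le_abs_self _))

/-- Under uniform Riemann integrability, the discrete uniform measures may be replaced by Lebesgue
measure. -/
theorem tendsto_lintegral_supDev_volume {Ω U : Type*} [MeasurableSpace Ω] [MeasurableSpace U]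
    (P : Measure Ω) [IsProbabilityMeasure P] (ν : Measure U) [SFinite ν] {X : ℕ → Ω → U}
    {H : Set (unitInterval → ℝ)} {G : Set (U → ℝ)}
    (hlim : Tendsto (fun n =>
      ∫⁻ ω, supDev X n (prodClass H G) ((unifDiscrete n).prod ν) ω ∂P) atTop (𝓝 0))
    (hR : UnifRiemannIntegrable H) {E : U → ℝ} (hEi : Integrable E ν)
    (hE : ∀ g ∈ G, ∀ x, |g x| ≤ E x) :
    Tendsto (fun n => ∫⁻ ω, supDev X n (prodClass H G)
      ((volume : Measure unitInterval).prod ν) ω ∂P) atTop (𝓝 0) := by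
  have h := hlim.add (ENNReal.Tendsto.mul_const hR (b := ∫⁻ x, ‖E x‖ₑ ∂ν) (.inr hEi.2.ne))
  rw [zero_mul, add_zero] at h
  refine tendsto_of_tendsto_of_tendsto_of_le_of_le tendsto_const_nhds h (fun _ => zero_le)
    fun n => ?_
  refine (lintegral_mono (supDev_volume_le X n ν hE)).trans_eq ?_
  rw [lintegral_add_right _ measurable_const, lintegral_const, measure_univ, mul_one]

/-! ### Convergence in `L_p` -/

lemma tendstoZeroLp_one {Ω : Type*} [MeasurableSpace Ω] {P : Measure Ω} {Y : ℕ → Ω → ℝ≥0∞}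
    (hm : ∀ n, AEMeasurable (Y n) P) (hfin : ∀ n, ∫⁻ ω, Y n ω ∂P < ⊤)
    (hlim : Tendsto (fun n => ∫⁻ ω, Y n ω ∂P) atTop (𝓝 0)) : TendstoZeroLp P 1 Y := by
  have h : ∀ n, eLpNorm (Y n) (ENNReal.ofReal 1) P = ∫⁻ ω, Y n ω ∂P := fun n => by
    rw [ENNReal.ofReal_one, eLpNorm_one_eq_lintegral_enorm]
    simp
  refine ⟨fun n => ⟨(hm n).aestronglyMeasurable, ?_⟩, ?_⟩
  · rw [h]; exact hfin n
  · simpa only [h] using hlim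

/-- Interpolation: Y ^ p ≤ C ^ (p - 1) * Y. -/
lemma tendstoZeroLp_of_le {Ω : Type*} [MeasurableSpace Ω] {P : Measure Ω}
    {Y : ℕ → Ω → ℝ≥0∞} (hm : ∀ n, AEMeasurable (Y n) P) (hfin : ∀ n, ∫⁻ ω, Y n ω ∂P < ⊤)
    (hlim : Tendsto (fun n => ∫⁻ ω, Y n ω ∂P) atTop (𝓝 0)) {C : ℝ≥0∞} (hC : C ≠ ⊤)
    (hYC : ∀ n ω, Y n ω ≤ C) {p : ℝ} (hp : 1 ≤ p) : TendstoZeroLp P p Y := by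
  have hp0 : 0 < p := one_pos.trans_le hp
  have hCp : C ^ (p - 1) ≠ ⊤ := ENNReal.rpow_ne_top_of_nonneg (by linarith) hC
  have h : ∀ n, eLpNorm (Y n) (ENNReal.ofReal p) P ≤
      (C ^ (p - 1) * ∫⁻ ω, Y n ω ∂P) ^ (1 / p) := by
    intro n
    rw [eLpNorm_eq_lintegral_rpow_enorm_toReal (by simpa using hp0) ENNReal.ofReal_ne_top,
      ENNReal.toReal_ofReal hp0.le, ← lintegral_const_mul'' _ (hm n)]
    refine ENNReal.rpow_le_rpow (lintegral_mono fun ω => ?_) (by positivity)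
    change Y n ω ^ p ≤ C ^ (p - 1) * Y n ω
    calc Y n ω ^ p = Y n ω ^ (p - 1 + 1) := by rw [sub_add_cancel]
      _ = Y n ω ^ (p - 1) * Y n ω := by
        rw [ENNReal.rpow_add_of_nonneg _ _ (by linarith) zero_le_one, ENNReal.rpow_one]
      _ ≤ _ := mul_le_mul_left (ENNReal.rpow_le_rpow (hYC n ω) (by linarith)) _
  refine ⟨fun n => ⟨(hm n).aestronglyMeasurable, (h n).trans_lt ?_⟩, ?_⟩
  · exact ENNReal.rpow_lt_top_of_nonneg (by positivity)
      (ENNReal.mul_lt_top hCp.lt_top (hfin n)).ne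
  · have h1 := (ENNReal.Tendsto.const_mul hlim (a := C ^ (p - 1)) (.inr hCp)).ennrpow_const (1 / p)
    rw [mul_zero, ENNReal.zero_rpow_of_pos (by positivity)] at h1
    exact tendsto_of_tendsto_of_tendsto_of_le_of_le tendsto_const_nhds h1 (fun _ => zero_le) h

lemma supDev_le_of_bounded {Ω U : Type*} [MeasurableSpace U] (X : ℕ → Ω → U) (n : ℕ)
    {H : Set (unitInterval → ℝ)} {G : Set (U → ℝ)} (ρ : Measure unitInterval) [SFinite ρ]
    (ν : Measure U) [IsProbabilityMeasure ν] {M L : ℝ} (hH : ∀ h ∈ H, ∀ s, |h s| ≤ M)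
    (hρ : ∀ h ∈ H, |∫ s, h s ∂ρ| ≤ M) (hG : Permissible G) (hL : ∀ g ∈ G, ∀ x, |g x| ≤ L)
    (ω : Ω) : supDev X n (prodClass H G) (ρ.prod ν) ω ≤
      ENNReal.ofReal M * (‖L‖ₑ + ‖L‖ₑ) := by
  have hGi : ∀ g ∈ G, Integrable g ν := fun g hg =>
    .of_bound (hG.measurable hg).aestronglyMeasurable L (.of_forall fun x => hL g hg x)
  refine (supDev_le_supDev_indicator_add X n ρ ν hH hρ hGi hL MeasurableSet.empty ω).trans ?_
  have h0 : supDev X n (prodClass H ((∅ : Set U).indicator '' G)) (ρ.prod ν) ω = 0 := by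
    rw [supDev_prodClass]
    simp
  rw [h0, zero_add]
  gcongr
  · exact inv_mul_le_of_le_nsmul (by simp)
  · simp

lemma abs_integral_volume_le {h : unitInterval → ℝ} {M : ℝ} (hM : ∀ s, |h s| ≤ M) :
    |∫ s, h s ∂(volume : Measure unitInterval)| ≤ M := by
  simpa using norm_integral_le_of_norm_le_const (f := h) (μ := (volume : Measure unitInterval))
    (.of_forall hM)

end SeqEmp

end

theorem corollary2 {Ω U : Type*} [MeasurableSpace Ω] [MeasurableSpace U]
    (P : Measure Ω) [IsProbabilityMeasure P] (ν : Measure U) [IsProbabilityMeasure ν]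
    (X : ℕ → Ω → U) (hX : ∀ i, Measurable (X i)) (hindep : iIndepFun X P)
    (hlaw : ∀ i, P.map (X i) = ν)
    (H : Set (unitInterval → ℝ)) (G : Set (U → ℝ))
    (hH : SeqEmp.Permissible H) (hG : SeqEmp.Permissible G) :
    (SeqEmp.JointVC ν H G →
      SeqEmp.TendstoZeroLp P 1 (fun n =>
        SeqEmp.supDev X n (SeqEmp.prodClass H G) ((SeqEmp.unifDiscrete n).prod ν)) ∧
      (SeqEmp.UnifRiemannIntegrable H →
        SeqEmp.TendstoZeroLp P 1 (fun n =>
          SeqEmp.supDev X n (SeqEmp.prodClass H G)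
            ((volume : Measure unitInterval).prod ν)))) ∧
    (SeqEmp.BoundedMarginalVC H G →
      (∀ p : ℝ, 1 ≤ p →
        SeqEmp.TendstoZeroLp P p (fun n =>
          SeqEmp.supDev X n (SeqEmp.prodClass H G) ((SeqEmp.unifDiscrete n).prod ν))) ∧
      (SeqEmp.UnifRiemannIntegrable H →
        ∀ p : ℝ, 1 ≤ p →
          SeqEmp.TendstoZeroLp P p (fun n =>
            SeqEmp.supDev X n (SeqEmp.prodClass H G)
              ((volume : Measure unitInterval).prod ν)))) := by
  have hm := fun n (ρ : Measure unitInterval) [SFinite ρ] =>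
    SeqEmp.aemeasurable_supDev P hX n hH hG ρ ν
  constructor
  · rintro ⟨⟨hHb, hHvc, -⟩, ⟨hGvc, E, hEi, hE⟩, -⟩
    have hlim := SeqEmp.tendsto_lintegral_supDev P ν hX hlaw hindep hH hG hHb hHvc hGvc hEi hE
    obtain ⟨M, hM⟩ := hHb
    refine ⟨SeqEmp.tendstoZeroLp_one (fun n => hm n _) (fun n => ?_) hlim, fun hR =>
      SeqEmp.tendstoZeroLp_one (fun n => hm n _) (fun n => ?_)
        (SeqEmp.tendsto_lintegral_supDev_volume P ν hlim hR hEi hE)⟩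
    · exact SeqEmp.lintegral_supDev_lt_top P ν hX hlaw hM _
        (fun h hh => SeqEmp.abs_integral_unifDiscrete_le (hM h hh)) hEi hG hE n
    · exact SeqEmp.lintegral_supDev_lt_top P ν hX hlaw hM _
        (fun h hh => SeqEmp.abs_integral_volume_le (hM h hh)) hEi hG hE n
  · rintro ⟨⟨hHb, hHvc, -⟩, hGvc, L, hL⟩
    -- A constant is an integrable envelope, so the convergence in mean covers this case as well.
    have hEi : Integrable (fun _ : U => L) ν := integrable_const L
    have hlim := SeqEmp.tendsto_lintegral_supDev P ν hX hlaw hindep hH hG hHb hHvc hGvc hEi hL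
    obtain ⟨M, hM⟩ := hHb
    have hC : ENNReal.ofReal M * (‖L‖ₑ + ‖L‖ₑ) ≠ ⊤ :=
      ENNReal.mul_ne_top ENNReal.ofReal_ne_top (by simp)
    refine ⟨fun p hp => SeqEmp.tendstoZeroLp_of_le (fun n => hm n _) (fun n => ?_) hlim hC
        (fun n ω => ?_) hp, fun hR p hp => SeqEmp.tendstoZeroLp_of_le (fun n => hm n _)
        (fun n => ?_) (SeqEmp.tendsto_lintegral_supDev_volume P ν hlim hR hEi hL) hC
        (fun n ω => ?_) hp⟩
    · exact SeqEmp.lintegral_supDev_lt_top P ν hX hlaw hM _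
        (fun h hh => SeqEmp.abs_integral_unifDiscrete_le (hM h hh)) hEi hG hL n
    · exact SeqEmp.supDev_le_of_bounded X n _ ν hM
        (fun h hh => SeqEmp.abs_integral_unifDiscrete_le (hM h hh)) hG hL ω
    · exact SeqEmp.lintegral_supDev_lt_top P ν hX hlaw hM _
        (fun h hh => SeqEmp.abs_integral_volume_le (hM h hh)) hEi hG hL n
    · exact SeqEmp.supDev_le_of_bounded X n _ ν hM
        (fun h hh => SeqEmp.abs_integral_volume_le (hM h hh)) hG hL ω
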